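/- Conventions. $PSL(2,\mathbb C)$ acts on $\hat{\mathbb C}=\mathbb C\cup\{\infty\}$ by Möbius transformations and on hyperbolic space $\mathbb H^3$ by isometries. $[x,y]$ ($x\ne y$ in $\hat{\mathbb C}$) is the oriented hyperbolic line from $x$ to $y$; $R_{X,\tau}$ is the rotation through the angle $\tau$ about the line $X$, $T_{X,d}$ is the hyperbolic translation by the distance $d$ along $X$ ($T_{X,0}=1$), and $H_X=R_{X,\pi}$ is the half-turn about $X$. The axis $Ax_A$ of a loxodromic or elliptic $A$ is the line joining its fixed points. If $A$ is parabolic with fixed point $u$, its axis is the improper line $[u,u]$, and a line is perpendicular to it when $u$ is one of its ends. A triple $(\mathbb P_A,\mathbb P,\mathbb P_B)$ of hyperbolic planes is an nsdc triple (non-separating disjoint circles) if the three horizons, circles on $\hat{\mathbb C}$, are pairwise disjoint or tangent and no one of them separates the other two. A marked group $\langle A,B\rangle\subset PSL(2,\mathbb C)$, that is, an ordered pair of generators, belongs to the planar family of this triple if the axes of $A$ and $B$ have a unique common perpendicular $L$ and there are lines $L_A\subset\mathbb P_A$, $L_B\subset\mathbb P_B$ with $L\subset\mathbb P$, $A=H_{L_A}H_L$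 and $B=H_{L_B}H_L$. If $L_A=[a,a']$, $L=[n,n']$, $L_B=[b,b']$, then $(a,a',n,n',b,b')$ is the ortho-end of the group (each line being taken with either orientation). When $k,k'$ are finite, the plane with pull-back angle $\theta\in[-\pi/2,\pi/2)$ through $[k,k']$ is the one whose horizon is the circle through $k,k'$ with center $\frac{k+k'}2+i\tan\theta\,\frac{k-k'}2$ (the straight line through $k,k'$ if $\theta=-\pi/2$). Moves. Fix a group $G=\langle A,B\rangle$ in the planar family of an nsdc triple $(\mathbb P_A,\mathbb P,\mathbb P_B)$, with lines $L_A,L,L_B$, its ortho-end, and the pull-back angles $(\theta_A,\theta,\theta_B)$ of the three planes with respect to these lines. Let $v_A=L_A\cap Ax_A$, $v=L\cap Ax_A$, $v_B=L_B\cap Ax_B$ (if $A$ is parabolic, $v_A$ and $v$ are arbitrary points of $L_A$ and $L$; if $B$ is parabolic, $v_B$ is an arbitrary point of $L_B$). Let $V_A$ be the line through $v_A$ perpendicular to $\mathbb P_A$ and $M_A$ the line on $\mathbb P_A$ through $v_A$ perpendicular to $L_A$, with any fixed orientations. The $(d_A,\tau_A)$ moves replace $L_A$ by $$L_{A'}=T_{X,d_A}(Y),\qquad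 X=R_{V_A,\tau_A}(M_A),\quad Y=R_{V_A,\tau_A}(L_A).$$ In the same way the $(d,\tau)$ moves replace $L$ by $L'$ (using $\mathbb P$ and $v$) and the $(d_B,\tau_B)$ moves replace $L_B$ by $L_{B'}$ (using $\mathbb P_B$ and $v_B$). Theorem. The six real numbers $\big((d_A,\tau_A),(d,\tau),(d_B,\tau_B)\big)\in\big([0,\infty)\times(-\pi,\pi]\big)^3$ are moduli for the planar family of $(\mathbb P_A,\mathbb P,\mathbb P_B)$, in the following sense. 1. For every choice of the six numbers, the marked group $G'=\langle A',B'\rangle$ with $A'=H_{L_{A'}}H_{L'}$ and $B'=H_{L_{B'}}H_{L'}$ belongs to the planar family, and the ends of $L_{A'}$, $L'$, $L_{B'}$ form an ortho-end of $G'$; in particular $L_{A'}\subset\mathbb P_A$, $L'\subset\mathbb P$, $L_{B'}\subset\mathbb P_B$. 2. Every marked group $G'=\langle A',B'\rangle$ in the planar family arises in this way from some choice of the six numbers. 3. Two choices give the same marked group $(A',B')$ if and only if each of the three pairs is the same in both choices or, for that pair, the distance is $0$ in both choices and the two angles differ by exactly $\pi$. -/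

import Mathlib

open scoped MatrixGroups OnePoint ComplexOrder

noncomputable section

namespace NsdcPlanar

/-! ### The Riemann sphere and the Möbius action of `PSL(2, ℂ)` -/

/-- `PSL(2, ℂ)` acts on the Riemann sphere `ℂ ∪ {∞}` by Möbius transformations, through the
identification of the sphere with the complex projective line. -/
instance mobiusAction : MulAction PSL(2, ℂ) (OnePoint ℂ) :=
  (OnePoint.equivProjectivization ℂ).mulAction PSL(2, ℂ)

/-- Homogeneous coordinates of a point of the Riemann sphere: `∞ ↦ (1, 0)` and `z ↦ (z, 1)`. -/
def homog (x : OnePoint ℂ) : Fin 2 → ℂ := x.elim ![1, 0] (fun z => ![z, 1])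

/-! ### Hyperbolic three-space

Points of `ℍ³` are the positive definite Hermitian `2 × 2` matrices of determinant `1`; the point
`(z, t)` of the upper half-space is the matrix `t⁻¹ !![|z|² + t², z; conj z, 1]`.  The form
`minkowski` polarizes the determinant, tangent vectors at `X` are the Hermitian matrices `T` with
`minkowski X T = 0`, and `- minkowski / 2` is the hyperbolic metric on them.  The point `x` of
the sphere at infinity corresponds to the ray spanned by `homog x * (homog x)ᴴ`. -/

/-- The polarization `det (X + Y) - det X - det Y` of the determinant (real for Hermitian
matrices). -/
def minkowski (X Y : Matrix (Fin 2) (Fin 2) ℂ) : ℝ := (X * Y.adjugate).trace.re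

/-- Hyperbolic three-space. -/
def H3 : Type := {X : Matrix (Fin 2) (Fin 2) ℂ // X.PosDef ∧ X.det = 1}

/-- The rank one Hermitian matrix on the light cone that represents a point of the sphere at
infinity. -/
def null (x : OnePoint ℂ) : Matrix (Fin 2) (Fin 2) ℂ :=
  Matrix.of fun i j => homog x i * star (homog x j)

/-- An oriented (proper) hyperbolic line `[src, tgt]`, given by its two distinct ends. -/
@[ext] structure Line where
  src : OnePoint ℂ
  tgt : OnePoint ℂ
  ne : src ≠ tgt

/-- The tangent vector of unit length at the point `X` of the line `[src, tgt]`, pointing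
towards `tgt`. In particular `X` is a point of the line. -/
def Line.IsTangentAt (K : Line) (X : H3) (T : Matrix (Fin 2) (Fin 2) ℂ) : Prop :=
  ∃ s t : ℝ, 0 < s ∧ 0 < t ∧ X.1 = s • null K.src + t • null K.tgt ∧
    T = t • null K.tgt - s • null K.src

/-- The points of a line in hyperbolic space. -/
def Line.points (K : Line) : Set H3 :=
  {X | ∃ s t : ℝ, 0 < s ∧ 0 < t ∧ X.1 = s • null K.src + t • null K.tgt}

/-- Two lines meet at a right angle at the point `X`. -/
def Line.IsPerpAt (K M : Line) (X : H3) : Prop :=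
  ∃ T U, K.IsTangentAt X T ∧ M.IsTangentAt X U ∧ minkowski T U = 0

/-- Two lines are perpendicular: they meet at a right angle. -/
def Line.IsPerp (K M : Line) : Prop := ∃ X, K.IsPerpAt M X

/-- A hyperbolic plane, given by a normal vector: an indefinite Hermitian matrix. -/
structure Plane where
  normal : Matrix (Fin 2) (Fin 2) ℂ
  isHermitian : normal.IsHermitian
  det_neg : normal.det.re < 0

/-- The points of a plane in hyperbolic space. -/
def Plane.points (P : Plane) : Set H3 := {X | minkowski P.normal X.1 = 0}

/-- The quadratic form whose zero set on the sphere is the horizon of the plane; the two open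
discs bounded by the horizon are the sets where it is positive and where it is negative. -/
def Plane.form (P : Plane) (z : OnePoint ℂ) : ℝ := minkowski P.normal (null z)

/-- The horizon of a plane: a circle on the Riemann sphere. -/
def Plane.horizon (P : Plane) : Set (OnePoint ℂ) := {z | P.form z = 0}

/-- The line lies on the plane. -/
def Line.LiesOn (K : Line) (P : Plane) : Prop := K.points ⊆ P.points

/-- The line is perpendicular to the plane at the point `X` of the plane. -/
def Line.IsPerpPlaneAt (V : Line) (P : Plane) (X : H3) : Prop :=
  X ∈ P.points ∧ ∃ T, V.IsTangentAt X T ∧ ∃ c : ℝ, T = c • P.normal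

/-! ### Rotations, translations and half-turns -/

/-- The matrix whose columns are homogeneous coordinates of the ends of a line. -/
def Line.frame (K : Line) : Matrix (Fin 2) (Fin 2) ℂ :=
  Matrix.of fun i j => if j = 0 then homog K.src i else homog K.tgt i

theorem Line.det_frame_ne_zero (K : Line) : K.frame.det ≠ 0 := by
  obtain ⟨x, y, h⟩ := K
  induction x using OnePoint.rec with
  | infty =>
    induction y using OnePoint.rec with
    | infty => exact absurd rfl h
    | coe y => simp [Line.frame, homog, Matrix.det_fin_two]
  | coe x =>
    induction y using OnePoint.rec with
    | infty => simp [Line.frame, homog, Matrix.det_fin_two]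
    | coe y =>
      have hxy : x ≠ y := fun e => h (by rw [e])
      simpa [Line.frame, homog, Matrix.det_fin_two, sub_eq_zero] using hxy

/-- The matrix with eigenvectors `src`, `tgt` and eigenvalues `exp (-c/2)`, `exp (c/2)`. -/
def screwMatrix (K : Line) (c : ℂ) : Matrix (Fin 2) (Fin 2) ℂ :=
  K.frame * Matrix.diagonal ![Complex.exp (-c / 2), Complex.exp (c / 2)] * K.frame⁻¹

theorem det_screwMatrix (K : Line) (c : ℂ) : (screwMatrix K c).det = 1 := by
  have hu : IsUnit K.frame.det := isUnit_iff_ne_zero.mpr K.det_frame_ne_zero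
  rw [screwMatrix, Matrix.det_mul, Matrix.det_mul, Matrix.det_diagonal, Fin.prod_univ_two,
    mul_right_comm, ← Matrix.det_mul, Matrix.mul_nonsing_inv _ hu, Matrix.det_one, one_mul]
  simp only [Matrix.cons_val_zero, Matrix.cons_val_one]
  rw [← Complex.exp_add]
  ring_nf
  exact Complex.exp_zero

/-- `screwMatrix` as an element of `SL(2, ℂ)`. -/
def screwSL (K : Line) (c : ℂ) : SL(2, ℂ) := ⟨screwMatrix K c, det_screwMatrix K c⟩

/-- The Möbius transformation with fixed points `src` and `tgt` that moves along the line
`[src, tgt]` by the distance `Re c` towards `tgt` and rotates about it by the angle `Im c`. For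
the line `[0, ∞]` it is `z ↦ exp c * z`. -/
def screw (K : Line) (c : ℂ) : PSL(2, ℂ) := QuotientGroup.mk (screwSL K c)

/-- The rotation `R_{K, τ}` through the angle `τ` about the line `K`. -/
def rotation (K : Line) (τ : ℝ) : PSL(2, ℂ) := screw K (τ * Complex.I)

/-- The hyperbolic transformation `T_{K, d}` with axis `K` and translation length `d`. -/
def translation (K : Line) (d : ℝ) : PSL(2, ℂ) := screw K d

/-- The half-turn `H_K` about the line `K`. -/
def halfTurn (K : Line) : PSL(2, ℂ) := rotation K Real.pi

/-- The image of an oriented line under a Möbius transformation. -/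
def moveLine (g : PSL(2, ℂ)) (K : Line) : Line :=
  ⟨g • K.src, g • K.tgt, fun h => K.ne (MulAction.injective g h)⟩

/-! ### Axes, ortho-ends and the planar family -/

/-- The fixed points of a Möbius transformation on the Riemann sphere. -/
def fixedSet (A : PSL(2, ℂ)) : Set (OnePoint ℂ) := {z | A • z = z}

/-- `N` is the (proper) axis of `A`, with some orientation. -/
def IsAxis (A : PSL(2, ℂ)) (N : Line) : Prop := fixedSet A = {N.src, N.tgt}

/-- `L` is perpendicular to the axis of `A`. If `A` is parabolic with fixed point `u`, its axis is
the improper line `[u, u]`, and a line is perpendicular to it when `u` is one of its ends. -/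
def IsPerpToAxis (A : PSL(2, ℂ)) (L : Line) : Prop :=
  (∃ N : Line, IsAxis A N ∧ L.IsPerp N) ∨ (∃ u, fixedSet A = {u} ∧ (L.src = u ∨ L.tgt = u))

/-- `L` (with some orientation) is the unique common perpendicular of the axes of `A` and `B`. -/
def IsCommonPerp (A B : PSL(2, ℂ)) (L : Line) : Prop :=
  IsPerpToAxis A L ∧ IsPerpToAxis B L ∧
    ∀ K : Line, IsPerpToAxis A K → IsPerpToAxis B K →
      ({K.src, K.tgt} : Set (OnePoint ℂ)) = {L.src, L.tgt}

/-- The ends of the lines `LA`, `L`, `LB` form the ortho-end of the marked group `⟨A, B⟩`: `L` is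
the common perpendicular of the axes, and `A = H_{LA} H_L`, `B = H_{LB} H_L`. -/
def IsOrthoEnd (A B : PSL(2, ℂ)) (LA L LB : Line) : Prop :=
  IsCommonPerp A B L ∧ A = halfTurn LA * halfTurn L ∧ B = halfTurn LB * halfTurn L

/-- The horizons of the two planes are disjoint or tangent. -/
def DisjointOrTangent (P Q : Plane) : Prop := (P.horizon ∩ Q.horizon).Subsingleton

/-- The horizon of `P` does not separate the horizons of `Q` and `R`: these lie in one and the
same closed disc bounded by the horizon of `P`. -/
def NotSeparating (P Q R : Plane) : Prop :=
  (∀ z ∈ Q.horizon ∪ R.horizon, 0 ≤ P.form z) ∨ (∀ z ∈ Q.horizon ∪ R.horizon, P.form z ≤ 0)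

/-- An nsdc triple of planes: the horizons are pairwise disjoint or tangent, and no one of them
separates the other two. -/
def IsNsdcTriple (PA P PB : Plane) : Prop :=
  DisjointOrTangent PA P ∧ DisjointOrTangent P PB ∧ DisjointOrTangent PA PB ∧
    NotSeparating PA P PB ∧ NotSeparating P PA PB ∧ NotSeparating PB PA P

/-- The marked group `⟨A, B⟩` is an nsdc group whose ortho-end is given by the lines `LA`, `L`,
`LB`, and for which the horizons of the planes `PA`, `P`, `PB` are nsdc circles. -/
def IsNsdcGroupOn (PA P PB : Plane) (A B : PSL(2, ℂ)) (LA L LB : Line) : Prop :=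
  IsNsdcTriple PA P PB ∧ IsOrthoEnd A B LA L LB ∧ LA.LiesOn PA ∧ L.LiesOn P ∧ LB.LiesOn PB

/-- The planar family of a triple of planes: all marked nsdc groups `⟨A, B⟩`, as pairs of
generators, whose nsdc planes are the given ones. -/
def planarFamily (PA P PB : Plane) : Set (PSL(2, ℂ) × PSL(2, ℂ)) :=
  {G | ∃ LA L LB, IsNsdcGroupOn PA P PB G.1 G.2 LA L LB}

/-- The marked group `⟨H_{LA} H_L, H_{LB} H_L⟩` of three lines, as a pair of generators. -/
def markedGroup (LA L LB : Line) : PSL(2, ℂ) × PSL(2, ℂ) :=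
  (halfTurn LA * halfTurn L, halfTurn LB * halfTurn L)

/-! ### Pull-back angles -/

/-- The circle through `k ≠ k'` with pull-back angle `θ`, `-π/2 ≤ θ < π/2`: its center is
`(k + k') / 2 + i tan θ (k - k') / 2`; for `θ = -π/2` it is the straight line through `k`, `k'`. -/
def pullBackCircle (k k' : ℂ) (θ : ℝ) : Set (OnePoint ℂ) :=
  if θ = -(Real.pi / 2) then
    insert ∞ ((fun z : ℂ => (z : OnePoint ℂ)) '' {z | ∃ s : ℝ, z = k + s * (k' - k)})
  else
    (fun z : ℂ => (z : OnePoint ℂ)) ''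
      Metric.sphere ((k + k') / 2 + Complex.I * (Real.tan θ : ℂ) * ((k - k') / 2))
        (‖k - k'‖ / (2 * Real.cos θ))

/-- `θ` is the pull-back angle of the plane `P` with respect to the line `K` on it. If an end of
`K` is `∞`, the angle carries no information. -/
def IsPullBackAngle (P : Plane) (K : Line) (θ : ℝ) : Prop :=
  θ ∈ Set.Ico (-(Real.pi / 2)) (Real.pi / 2) ∧
    ∀ k k' : ℂ, K.src = k → K.tgt = k' → P.horizon = pullBackCircle k k' θ

/-! ### The moves -/

/-- Base point and auxiliary lines of the moves of the line `K` on the plane `P`, where `A` is the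
generator whose axis meets `K`: the base point `v` is the intersection of `K` with the axis of `A`
(any point of `K` if `A` is parabolic), `V` is the perpendicular to `P` at `v`, and `M` is the line
on `P` that is perpendicular to `K` at `v`; both with any orientation. -/
def IsMoveFrame (P : Plane) (A : PSL(2, ℂ)) (K : Line) (v : H3) (V M : Line) : Prop :=
  v ∈ K.points ∧ (∀ N : Line, IsAxis A N → v ∈ N.points) ∧
    V.IsPerpPlaneAt P v ∧ M.LiesOn P ∧ M.IsPerpAt K v

/-- The `(d, τ)`-moves of the line `K`: first rotate `K` and `M` about `V` through the angle `τ`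
to lines `Y` and `X`, then translate `Y` along `X` by the distance `d`. -/
def moves (V M K : Line) (q : ℝ × ℝ) : Line :=
  moveLine (translation (moveLine (rotation V q.2) M) q.1) (moveLine (rotation V q.2) K)

/-- The parameter set `[0, ∞) × (-π, π]` of one pair `(d, τ)`. -/
def moduliFactor : Set (ℝ × ℝ) := Set.Ici 0 ×ˢ Set.Ioc (-Real.pi) Real.pi

/-- Two pairs `(d, τ)` are equal, or `d = 0` in both and the angles differ by `π` (so that the moved
lines agree up to orientation). -/
def SameMove (q r : ℝ × ℝ) : Prop :=
  q = r ∨ (q.1 = 0 ∧ r.1 = 0 ∧ (q.2 - r.2 = Real.pi ∨ r.2 - q.2 = Real.pi))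

end NsdcPlanar

end

open NsdcPlanar

namespace NsdcPlanar

open Matrix

/-! ### Homogeneous coordinates -/

/-! A line is encoded by the traceless involution `K.invol` with eigenvectors at its two ends;
reversing the line changes the sign, and the half-turn is the class of `I • K.invol`. Geometry
becomes linear algebra of traceless matrices under the trace form: lines are perpendicular iff their
involutions are trace-orthogonal (`Line.isPerp_iff`), and a line is perpendicular to the axis of a
non-scalar `g` iff `(g.1 * K.invol).trace = 0`, parabolic case included.

The lines on a plane are, up to sign, the unit vectors of a real three-dimensional space of
signature (2,1). In the orthogonal basis `K`, `M`, `iV` given by a move frame, the moved line has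
coordinates `(cosh d cos τ, ε cosh d sin τ, ε sinh d)` with `ε = ±1` (`PauliTriple.invol_moves`).
These are polar coordinates on the hyperboloid of one sheet, so up to sign every line on the plane
is reached, and the only ambiguity is the antipodal one at `d = 0`.

The three lines can be varied independently because the nsdc condition does the rest. A common
perpendicular of three lines on the three planes would have a middle foot, whose plane would
separate the other two; a common end would give three parallel lines with the same defect. Hence the
three involutions are linearly independent (`IsNsdcTriple.eq_zero_of_trace_eq_zero`), which makes
the middle line the unique common perpendicular of the axes (`IsNsdcTriple.isOrthoEnd`). So the
marked group determines the three unoriented lines. -/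

theorem homog_ne_zero (x : OnePoint ℂ) : homog x ≠ 0 := by
  induction x using OnePoint.rec with
  | infty => intro h; simpa [homog] using congrFun h 0
  | coe x => intro h; simpa [homog] using congrFun h 1

theorem equivProjectivization_eq_mk (x : OnePoint ℂ) :
    OnePoint.equivProjectivization ℂ x = Projectivization.mk ℂ (homog x) (homog_ne_zero x) := by
  induction x using OnePoint.rec with
  | infty => rfl
  | coe x => rfl

theorem eq_of_homog_eq_smul {x y : OnePoint ℂ} {c : ℂ} (h : homog x = c • homog y) : x = y := by
  apply (OnePoint.equivProjectivization ℂ).injective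
  rw [equivProjectivization_eq_mk, equivProjectivization_eq_mk, Projectivization.mk_eq_mk_iff']
  exact ⟨c, h.symm⟩

theorem exists_eq_smul_homog {v : Fin 2 → ℂ} (hv : v ≠ 0) :
    ∃ (x : OnePoint ℂ) (c : ℂ), c ≠ 0 ∧ v = c • homog x := by
  obtain ⟨x, hx⟩ := (OnePoint.equivProjectivization ℂ).surjective (Projectivization.mk ℂ v hv)
  rw [equivProjectivization_eq_mk, Projectivization.mk_eq_mk_iff'] at hx
  obtain ⟨a, ha⟩ := hx
  have ha0 : a ≠ 0 := by
    rintro rfl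
    exact homog_ne_zero x (by rw [← ha, zero_smul])
  exact ⟨x, a⁻¹, inv_ne_zero ha0, by rw [← ha, inv_smul_smul₀ ha0]⟩

theorem mk_smul_eq_iff (g : SL(2, ℂ)) (x y : OnePoint ℂ) :
    (QuotientGroup.mk g : PSL(2, ℂ)) • x = y ↔ ∃ c : ℂ, g.1 *ᵥ homog x = c • homog y := by
  have h : (QuotientGroup.mk g : PSL(2, ℂ)) • x = y ↔
      (QuotientGroup.mk g : PSL(2, ℂ)) • OnePoint.equivProjectivization ℂ x =
        OnePoint.equivProjectivization ℂ y :=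
    (OnePoint.equivProjectivization ℂ).symm_apply_eq
  rw [h, equivProjectivization_eq_mk, equivProjectivization_eq_mk,
    Matrix.ProjectiveSpecialLinearGroup.smul_proj_mk, Projectivization.smul_mk,
    Projectivization.mk_eq_mk_iff']
  exact ⟨fun ⟨c, hc⟩ => ⟨c, hc.symm⟩, fun ⟨c, hc⟩ => ⟨c, hc.symm⟩⟩

theorem exists_mulVec_homog_eq (g : SL(2, ℂ)) (x : OnePoint ℂ) :
    ∃ c : ℂ, c ≠ 0 ∧ g.1 *ᵥ homog x = c • homog ((QuotientGroup.mk g : PSL(2, ℂ)) • x) := by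
  obtain ⟨c, hc⟩ := (mk_smul_eq_iff g x _).1 rfl
  refine ⟨c, ?_, hc⟩
  rintro rfl
  rw [zero_smul] at hc
  refine homog_ne_zero x (Matrix.eq_zero_of_mulVec_eq_zero ?_ hc)
  rw [g.2]
  exact one_ne_zero

theorem mk_eq_mk_of_eq_or_neg {g h : SL(2, ℂ)} (H : g.1 = h.1 ∨ g.1 = -h.1) :
    (QuotientGroup.mk g : PSL(2, ℂ)) = QuotientGroup.mk h := by
  rcases H with H | H
  · rw [Subtype.ext H]
  · have : g = -h := Subtype.ext H
    rw [QuotientGroup.eq, this, Matrix.SpecialLinearGroup.mem_center_iff]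
    refine ⟨-1, by simp, ?_⟩
    rw [inv_neg, neg_mul, inv_mul_cancel]
    ext i j
    fin_cases i <;> fin_cases j <;> simp

/-! ### The involution of a line -/

/-- The traceless involution with eigenvectors `src`, `tgt` and eigenvalues `-1`, `1`. -/
noncomputable def Line.invol (K : Line) : Matrix (Fin 2) (Fin 2) ℂ :=
  K.frame * diagonal ![-1, 1] * K.frame⁻¹

theorem Line.isUnit_det_frame (K : Line) : IsUnit K.frame.det :=
  isUnit_iff_ne_zero.mpr K.det_frame_ne_zero

@[simp] theorem Line.frame_apply_zero (K : Line) (i : Fin 2) : K.frame i 0 = homog K.src i := rfl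

@[simp] theorem Line.frame_apply_one (K : Line) (i : Fin 2) : K.frame i 1 = homog K.tgt i := rfl

theorem Line.frame_mulVec (K : Line) (a b : ℂ) :
    K.frame *ᵥ ![a, b] = a • homog K.src + b • homog K.tgt := by
  rw [mulVec_fin_two]
  ext i
  fin_cases i <;> simp [mul_comm]

theorem Line.exists_combination (K : Line) (v : Fin 2 → ℂ) :
    ∃ a b : ℂ, v = a • homog K.src + b • homog K.tgt := by
  refine ⟨(K.frame⁻¹ *ᵥ v) 0, (K.frame⁻¹ *ᵥ v) 1, ?_⟩
  rw [← K.frame_mulVec]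
  have : ![(K.frame⁻¹ *ᵥ v) 0, (K.frame⁻¹ *ᵥ v) 1] = K.frame⁻¹ *ᵥ v := by
    ext i; fin_cases i <;> rfl
  rw [this, mulVec_mulVec, mul_nonsing_inv _ K.isUnit_det_frame, one_mulVec]

theorem Line.combination_eq_zero (K : Line) {a b : ℂ}
    (h : a • homog K.src + b • homog K.tgt = 0) : a = 0 ∧ b = 0 := by
  rw [← K.frame_mulVec] at h
  have := Matrix.eq_zero_of_mulVec_eq_zero K.det_frame_ne_zero h
  exact ⟨congrFun this 0, congrFun this 1⟩

theorem Line.invol_mulVec (K : Line) (a b : ℂ) :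
    K.invol *ᵥ (a • homog K.src + b • homog K.tgt) = (-a) • homog K.src + b • homog K.tgt := by
  rw [← K.frame_mulVec, ← K.frame_mulVec, Line.invol, mulVec_mulVec,
    nonsing_inv_mul_cancel_right _ _ K.isUnit_det_frame, ← mulVec_mulVec]
  congr 1
  ext i
  fin_cases i <;> simp

theorem Line.invol_mulVec_src (K : Line) : K.invol *ᵥ homog K.src = -homog K.src := by
  simpa using K.invol_mulVec 1 0

theorem Line.invol_mulVec_tgt (K : Line) : K.invol *ᵥ homog K.tgt = homog K.tgt := by
  simpa using K.invol_mulVec 0 1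

theorem Line.ext_mulVec (K : Line) {S T : Matrix (Fin 2) (Fin 2) ℂ}
    (hs : S *ᵥ homog K.src = T *ᵥ homog K.src) (ht : S *ᵥ homog K.tgt = T *ᵥ homog K.tgt) :
    S = T := by
  apply Matrix.ext_of_mulVec_single
  intro i
  obtain ⟨a, b, h⟩ := K.exists_combination (Pi.single i 1)
  rw [h, mulVec_add, mulVec_add, mulVec_smul, mulVec_smul, mulVec_smul, mulVec_smul, hs, ht]

theorem Line.invol_eq (K : Line) {S : Matrix (Fin 2) (Fin 2) ℂ}
    (hs : S *ᵥ homog K.src = -homog K.src) (ht : S *ᵥ homog K.tgt = homog K.tgt) :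
    K.invol = S :=
  K.ext_mulVec (by rw [hs, K.invol_mulVec_src]) (by rw [ht, K.invol_mulVec_tgt])

@[simp] theorem Line.invol_mul_self (K : Line) : K.invol * K.invol = 1 := by
  apply K.ext_mulVec <;>
    simp only [← mulVec_mulVec, K.invol_mulVec_src, K.invol_mulVec_tgt, mulVec_neg, neg_neg,
      one_mulVec]

@[simp] theorem Line.trace_invol (K : Line) : K.invol.trace = 0 := by
  rw [Line.invol, trace_mul_comm, nonsing_inv_mul_cancel_left _ _ K.isUnit_det_frame]
  simp

theorem Line.det_invol (K : Line) : K.invol.det = -1 := by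
  rw [Line.invol, det_mul, det_mul, det_nonsing_inv, mul_right_comm,
    Ring.mul_inverse_cancel _ K.isUnit_det_frame]
  simp

/-- For `e = ±1` the range of `S + e` consists of `e`-eigenvectors, because `S (S + e) = e (S + e)`.
It is nonzero because a scalar `S = -e` would have nonzero trace. -/
theorem exists_invol_eq {S : Matrix (Fin 2) (Fin 2) ℂ} (hS : S * S = 1) (htr : S.trace = 0) :
    ∃ K : Line, K.invol = S := by
  have key : ∀ e : ℂ, e * e = 1 → ∃ x, S *ᵥ homog x = e • homog x := by
    intro e he
    have h : ∃ v, (S + e • 1) *ᵥ v ≠ 0 := by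
      by_contra! h
      have h0 : S + e • 1 = 0 := by
        apply Matrix.ext_of_mulVec_single
        intro i
        rw [h, zero_mulVec]
      have := congrArg trace h0
      simp [htr] at this
      simp [this] at he
    obtain ⟨v, hv⟩ := h
    obtain ⟨x, c, hc, hx⟩ := exists_eq_smul_homog hv
    refine ⟨x, ?_⟩
    have h1 : S *ᵥ ((S + e • 1) *ᵥ v) = e • ((S + e • 1) *ᵥ v) := by
      rw [mulVec_mulVec, mul_add, hS, ← smul_mulVec, smul_add, smul_smul, he, one_smul,
        mul_smul_comm, mul_one, add_comm]
    rw [hx, mulVec_smul, smul_comm] at h1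
    exact smul_right_injective _ hc h1
  obtain ⟨x, hx⟩ := key (-1) (by ring)
  obtain ⟨y, hy⟩ := key 1 (by ring)
  rw [neg_one_smul] at hx
  rw [one_smul] at hy
  refine ⟨⟨x, y, ?_⟩, Line.invol_eq _ hx hy⟩
  rintro rfl
  rw [hx] at hy
  exact homog_ne_zero x (self_eq_neg.1 hy.symm)

theorem Line.eq_src_of_mulVec (K : Line) {x : OnePoint ℂ}
    (h : K.invol *ᵥ homog x = -homog x) : x = K.src := by
  obtain ⟨a, b, hx⟩ := K.exists_combination (homog x)
  rw [hx, K.invol_mulVec] at h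
  have h2 : (0 : ℂ) • homog K.src + (2 * b) • homog K.tgt = 0 := by
    have := congrArg (· + (a • homog K.src + b • homog K.tgt)) h
    simp only [neg_add_cancel] at this
    rw [← this]; module
  have hb : b = 0 := by simpa using (K.combination_eq_zero h2).2
  exact eq_of_homog_eq_smul (c := a) (by rw [hx, hb]; simp)

theorem Line.eq_tgt_of_mulVec (K : Line) {x : OnePoint ℂ}
    (h : K.invol *ᵥ homog x = homog x) : x = K.tgt := by
  obtain ⟨a, b, hx⟩ := K.exists_combination (homog x)
  rw [hx, K.invol_mulVec] at h
  have h2 : (-(2 * a)) • homog K.src + (0 : ℂ) • homog K.tgt = 0 := by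
    have := congrArg (· - (a • homog K.src + b • homog K.tgt)) h
    simp only [sub_self] at this
    rw [← this]; module
  have hb : a = 0 := by simpa using (K.combination_eq_zero h2).1
  exact eq_of_homog_eq_smul (c := b) (by rw [hx, hb]; simp)

theorem Line.eq_src_or_tgt_of_mulVec (K : Line) {x : OnePoint ℂ} {e : ℂ}
    (h : K.invol *ᵥ homog x = e • homog x) : x = K.src ∨ x = K.tgt := by
  have h2 : homog x = (e * e) • homog x := by
    conv_lhs => rw [← one_mulVec (homog x), ← K.invol_mul_self, ← mulVec_mulVec, h,
      mulVec_smul, h, smul_smul]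
  have h3 : (1 - e * e) • homog x = 0 := by rw [sub_smul, ← h2, one_smul, sub_self]
  have h4 : (1 - e) * (1 + e) = 0 := by
    have := (smul_eq_zero.1 h3).resolve_right (homog_ne_zero x)
    linear_combination this
  rcases mul_eq_zero.1 h4 with h5 | h5
  · right
    apply K.eq_tgt_of_mulVec
    rw [h, show e = 1 by linear_combination -h5, one_smul]
  · left
    apply K.eq_src_of_mulVec
    rw [h, show e = -1 by linear_combination h5, neg_one_smul]

/-- The set of ends determines the involution up to sign. -/
theorem Line.ends_eq_iff (K M : Line) :
    ({K.src, K.tgt} : Set (OnePoint ℂ)) = {M.src, M.tgt} ↔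
      K.invol = M.invol ∨ K.invol = -M.invol := by
  constructor
  · intro h
    rcases Set.pair_eq_pair_iff.1 h with ⟨h1, h2⟩ | ⟨h1, h2⟩
    · left
      apply K.invol_eq
      · rw [h1, M.invol_mulVec_src]
      · rw [h2, M.invol_mulVec_tgt]
    · right
      apply K.invol_eq
      · rw [h1, neg_mulVec, M.invol_mulVec_tgt]
      · rw [h2, neg_mulVec, M.invol_mulVec_src, neg_neg]
  · rintro (h | h)
    · have h1 := K.invol_mulVec_src
      have h2 := K.invol_mulVec_tgt
      rw [h] at h1 h2
      rw [M.eq_src_of_mulVec h1, M.eq_tgt_of_mulVec h2]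
    · have h1 := K.invol_mulVec_src
      have h2 := K.invol_mulVec_tgt
      rw [h, neg_mulVec] at h1 h2
      rw [M.eq_tgt_of_mulVec (neg_injective h1), M.eq_src_of_mulVec (neg_eq_iff_eq_neg.1 h2),
        Set.pair_comm]

/-! ### Screw motions and half-turns -/

/-- This is the exponential of `(c / 2) • K.invol`, whose series splits because the involution
squares to `1`. -/
theorem screwMatrix_eq (K : Line) (c : ℂ) :
    screwMatrix K c = Complex.cosh (c / 2) • 1 + Complex.sinh (c / 2) • K.invol := by
  have h : diagonal ![Complex.exp (-c / 2), Complex.exp (c / 2)] =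
      Complex.cosh (c / 2) • (1 : Matrix (Fin 2) (Fin 2) ℂ) +
        Complex.sinh (c / 2) • diagonal ![-1, 1] := by
    have h1 := Complex.cosh_sub_sinh (c / 2)
    have h2 := Complex.cosh_add_sinh (c / 2)
    ext i j
    fin_cases i <;> fin_cases j
    · simpa [neg_div, sub_eq_add_neg] using h1.symm
    · simp
    · simp
    · simp [h2]
  rw [screwMatrix, h, Line.invol, mul_add, add_mul, mul_smul_comm, mul_one, smul_mul_assoc,
    mul_nonsing_inv _ K.isUnit_det_frame, mul_smul_comm, smul_mul_assoc]

/-- The half-turn about a line as a matrix. -/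
noncomputable def halfTurnSL (K : Line) : SL(2, ℂ) :=
  ⟨Complex.I • K.invol, by simp [K.det_invol]⟩

theorem halfTurn_eq (K : Line) : halfTurn K = QuotientGroup.mk (halfTurnSL K) := by
  have : screwSL K (Real.pi * Complex.I) = halfTurnSL K := by
    apply Subtype.ext
    show screwMatrix _ _ = Complex.I • _
    have h : (Real.pi : ℂ) * Complex.I / 2 = (Real.pi / 2 : ℂ) * Complex.I := by ring
    rw [screwMatrix_eq, h, Complex.cosh_mul_I, Complex.sinh_mul_I, Complex.cos_pi_div_two,
      Complex.sin_pi_div_two]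
    simp
  rw [halfTurn, rotation, screw, this]

theorem fixedSet_mk_of_eq_add_invol {g : SL(2, ℂ)} {K : Line} {a b : ℂ} (hb : b ≠ 0)
    (hg : g.1 = a • 1 + b • K.invol) :
    fixedSet (QuotientGroup.mk g : PSL(2, ℂ)) = {K.src, K.tgt} := by
  ext x
  rw [fixedSet, Set.mem_ofPred_eq, mk_smul_eq_iff, hg]
  constructor
  · rintro ⟨c, hc⟩
    rw [add_mulVec, smul_mulVec, smul_mulVec, one_mulVec] at hc
    refine K.eq_src_or_tgt_of_mulVec (e := b⁻¹ * (c - a)) ?_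
    rw [mul_smul, sub_smul, ← hc, add_sub_cancel_left, inv_smul_smul₀ hb]
  · rintro (rfl | rfl)
    · refine ⟨a - b, ?_⟩
      rw [add_mulVec, smul_mulVec, smul_mulVec, K.invol_mulVec_src, one_mulVec]
      module
    · refine ⟨a + b, ?_⟩
      rw [add_mulVec, smul_mulVec, smul_mulVec, K.invol_mulVec_tgt, one_mulVec]
      module

theorem fixedSet_halfTurn (K : Line) : fixedSet (halfTurn K) = {K.src, K.tgt} := by
  rw [halfTurn_eq]
  exact fixedSet_mk_of_eq_add_invol (a := 0) Complex.I_ne_zero (by simp [halfTurnSL])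

theorem halfTurn_eq_halfTurn_iff (K M : Line) :
    halfTurn K = halfTurn M ↔ K.invol = M.invol ∨ K.invol = -M.invol := by
  constructor
  · intro h
    rw [← K.ends_eq_iff, ← fixedSet_halfTurn, ← fixedSet_halfTurn, h]
  · intro h
    rw [halfTurn_eq, halfTurn_eq]
    apply mk_eq_mk_of_eq_or_neg
    rcases h with h | h
    · left; simp [halfTurnSL, h]
    · right; simp [halfTurnSL, h]

theorem invol_moveLine (g : SL(2, ℂ)) (K : Line) :
    (moveLine (QuotientGroup.mk g) K).invol = g.1 * K.invol * (g⁻¹).1 := by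
  have hg : (g⁻¹).1 * g.1 = 1 := by
    rw [← Matrix.SpecialLinearGroup.coe_mul, inv_mul_cancel]; rfl
  have key : ∀ x : OnePoint ℂ, ∀ e : ℂ, K.invol *ᵥ homog x = e • homog x →
      (g.1 * K.invol * (g⁻¹).1) *ᵥ homog ((QuotientGroup.mk g : PSL(2, ℂ)) • x) =
        e • homog ((QuotientGroup.mk g : PSL(2, ℂ)) • x) := by
    intro x e hx
    obtain ⟨c, hc, h⟩ := exists_mulVec_homog_eq g x
    apply smul_right_injective _ hc
    dsimp only
    rw [← mulVec_smul, ← h, mulVec_mulVec, mul_assoc, hg, mul_one, ← mulVec_mulVec, hx,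
      mulVec_smul, h, smul_comm]
  apply Line.invol_eq
  · rw [← neg_one_smul ℂ]
    exact key K.src (-1) (by rw [neg_one_smul, K.invol_mulVec_src])
  · exact (key K.tgt 1 (by rw [one_smul, K.invol_mulVec_tgt])).trans (one_smul _ _)

/-! ### Traceless matrices -/

theorem apply_one_one_of_trace_eq_zero {R : Type*} [CommRing R] {S : Matrix (Fin 2) (Fin 2) R}
    (hS : S.trace = 0) : S 1 1 = -S 0 0 := by
  rw [trace_fin_two] at hS
  linear_combination hS

/-- Polarized Cayley–Hamilton: for traceless matrices, trace-orthogonal means anticommuting. -/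
theorem mul_add_mul_of_trace_eq_zero {R : Type*} [CommRing R] {S T : Matrix (Fin 2) (Fin 2) R}
    (hS : S.trace = 0) (hT : T.trace = 0) : S * T + T * S = (S * T).trace • 1 := by
  have h1 := apply_one_one_of_trace_eq_zero hS
  have h2 := apply_one_one_of_trace_eq_zero hT
  ext i j
  fin_cases i <;> fin_cases j <;> simp [mul_apply, Fin.sum_univ_two, trace_fin_two, h1, h2] <;> ring

theorem mul_eq_neg_mul_of_trace_eq_zero {R : Type*} [CommRing R] {S T : Matrix (Fin 2) (Fin 2) R}
    (hS : S.trace = 0) (hT : T.trace = 0) (h : (S * T).trace = 0) : S * T = -(T * S) := by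
  have := mul_add_mul_of_trace_eq_zero hS hT
  rw [h, zero_smul] at this
  exact eq_neg_of_add_eq_zero_left this

theorem mul_self_of_trace_eq_zero {R : Type*} [CommRing R] {S : Matrix (Fin 2) (Fin 2) R}
    (hS : S.trace = 0) : S * S = (-S.det) • 1 := by
  have h1 := apply_one_one_of_trace_eq_zero hS
  ext i j
  fin_cases i <;> fin_cases j <;> simp [mul_apply, Fin.sum_univ_two, det_fin_two, h1] <;> ring

/-! ### Points and tangent vectors of lines -/

theorem null_eq_vecMulVec (x : OnePoint ℂ) : null x = vecMulVec (homog x) (star (homog x)) := rfl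

theorem isHermitian_null (x : OnePoint ℂ) : (null x).IsHermitian := by
  ext i j
  simp [null, conjTranspose_apply, mul_comm]

theorem mul_null (S : Matrix (Fin 2) (Fin 2) ℂ) (x : OnePoint ℂ) :
    S * null x = vecMulVec (S *ᵥ homog x) (star (homog x)) := by
  rw [null_eq_vecMulVec, mul_vecMulVec]

theorem Line.invol_mul_null_src (K : Line) : K.invol * null K.src = -null K.src := by
  rw [mul_null, K.invol_mulVec_src, neg_vecMulVec, null_eq_vecMulVec]

theorem Line.invol_mul_null_tgt (K : Line) : K.invol * null K.tgt = null K.tgt := by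
  rw [mul_null, K.invol_mulVec_tgt, null_eq_vecMulVec]

theorem Line.frame_mul_diagonal_mul (K : Line) (a b : ℂ) :
    K.frame * diagonal ![a, b] * K.frameᴴ = a • null K.src + b • null K.tgt := by
  ext i j
  simp [mul_apply, Fin.sum_univ_two, null, conjTranspose_apply, diagonal_apply]
  ring

/-- In the frame of `K` the involution is `diag(-1, 1)` and `X` becomes a positive definite `Y`. If
`diag(-1, 1) * Y` is Hermitian, the off-diagonal entries of `Y` vanish, and its positive diagonal
entries are the coefficients `s`, `t`. The criterion thus also detects whether `X` lies on `K`. -/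
theorem Line.isTangentAt_iff (K : Line) (X : H3) (T : Matrix (Fin 2) (Fin 2) ℂ) :
    K.IsTangentAt X T ↔ T = K.invol * X.1 ∧ T.IsHermitian := by
  constructor
  · rintro ⟨s, t, hs, ht, hX, rfl⟩
    constructor
    · rw [hX, mul_add, mul_smul_comm, mul_smul_comm, K.invol_mul_null_src, K.invol_mul_null_tgt]
      module
    · have h1 := isHermitian_null K.src
      have h2 := isHermitian_null K.tgt
      rw [IsHermitian, conjTranspose_sub, conjTranspose_smul, conjTranspose_smul, h1.eq, h2.eq]
      simp
  · rintro ⟨rfl, hT⟩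
    set F := K.frame with hF
    have hu : IsUnit F := (isUnit_iff_isUnit_det _).2 K.isUnit_det_frame
    have hFi : F * F⁻¹ = 1 := mul_nonsing_inv _ K.isUnit_det_frame
    have hFi' : F⁻¹ * F = 1 := nonsing_inv_mul _ K.isUnit_det_frame
    set Y := F⁻¹ * X.1 * (F⁻¹)ᴴ with hY
    have hYpos : Y.PosDef := by
      rw [hY]
      refine X.2.1.mul_mul_conjTranspose_same (B := F⁻¹) ?_
      exact vecMul_injective_of_isUnit (by simpa using hu)
    have hXY : X.1 = F * Y * Fᴴ := by
      have h2 : (F⁻¹)ᴴ * Fᴴ = 1 := by rw [← conjTranspose_mul, hFi, conjTranspose_one]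
      rw [hY]
      simp only [mul_assoc, h2, mul_one]
      rw [← mul_assoc, hFi, one_mul]
    have hJ : F⁻¹ * (K.invol * X.1) * (F⁻¹)ᴴ = diagonal ![-1, 1] * Y := by
      rw [Line.invol, ← hF, hY]
      simp only [← mul_assoc, hFi', one_mul]
    have hDY : (diagonal ![-1, 1] * Y).IsHermitian := by
      rw [← hJ]
      exact isHermitian_mul_mul_conjTranspose _ hT
    have hY01 : Y 0 1 = 0 := by
      have h1 := hDY.apply 0 1
      have h2 := hYpos.1.apply 0 1
      simp at h1 h2
      rw [h2] at h1
      linear_combination (1 / 2 : ℂ) * h1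
    have hY10 : Y 1 0 = 0 := by
      rw [← hYpos.1.apply 1 0, hY01, star_zero]
    have h0 : 0 < Y 0 0 := hYpos.diag_pos
    have h1 : 0 < Y 1 1 := hYpos.diag_pos
    have hd : Y = diagonal ![Y 0 0, Y 1 1] := by
      ext i j
      fin_cases i <;> fin_cases j <;> simp [hY01, hY10]
    obtain ⟨s, hs⟩ : ∃ s : ℝ, Y 0 0 = s := ⟨(Y 0 0).re, by
      apply Complex.ext <;> simp [(Complex.pos_iff.1 h0).2.symm]⟩
    obtain ⟨t, ht⟩ : ∃ t : ℝ, Y 1 1 = t := ⟨(Y 1 1).re, by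
      apply Complex.ext <;> simp [(Complex.pos_iff.1 h1).2.symm]⟩
    rw [hs] at h0
    rw [ht] at h1
    have hX : X.1 = s • null K.src + t • null K.tgt := by
      rw [hXY, hd, hs, ht, hF, K.frame_mul_diagonal_mul]
      rfl
    refine ⟨s, t, by simpa using h0, by simpa using h1, hX, ?_⟩
    rw [hX, mul_add, mul_smul_comm, mul_smul_comm, K.invol_mul_null_src, K.invol_mul_null_tgt]
    module

theorem Line.IsTangentAt.mem_points {K : Line} {X : H3} {T : Matrix (Fin 2) (Fin 2) ℂ}
    (h : K.IsTangentAt X T) : X ∈ K.points := by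
  obtain ⟨s, t, hs, ht, hX, -⟩ := h
  exact ⟨s, t, hs, ht, hX⟩

theorem Line.det_frame_normSq_pos (K : Line) : 0 < Complex.normSq K.frame.det :=
  Complex.normSq_pos.2 K.det_frame_ne_zero

theorem Line.posDef_combination (K : Line) {s t : ℝ} (hs : 0 < s) (ht : 0 < t) :
    (s • null K.src + t • null K.tgt).PosDef := by
  have : s • null K.src + t • null K.tgt = K.frame * diagonal ![(s : ℂ), (t : ℂ)] * K.frameᴴ := by
    rw [K.frame_mul_diagonal_mul]; rfl
  rw [this]
  refine PosDef.mul_mul_conjTranspose_same (PosDef.diagonal ?_) ?_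
  · intro i
    fin_cases i <;> simpa
  · exact vecMul_injective_of_isUnit ((isUnit_iff_isUnit_det _).2 K.isUnit_det_frame)

theorem Line.det_combination (K : Line) (s t : ℝ) :
    (s • null K.src + t • null K.tgt).det = (s * t * Complex.normSq K.frame.det : ℝ) := by
  have : s • null K.src + t • null K.tgt = K.frame * diagonal ![(s : ℂ), (t : ℂ)] * K.frameᴴ := by
    rw [K.frame_mul_diagonal_mul]; rfl
  rw [this, det_mul, det_mul, det_conjTranspose, det_diagonal, Fin.prod_univ_two, mul_right_comm,
    Complex.star_def, Complex.mul_conj]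
  simp
  ring

/-- The point of a line with given ratio of the coefficients of its two ends. -/
theorem Line.exists_point (K : Line) {r : ℝ} (hr : 0 < r) :
    ∃ (X : H3) (s : ℝ), 0 < s ∧ X.1 = s • null K.src + (r * s) • null K.tgt := by
  set N := Complex.normSq K.frame.det with hN
  have hNpos : 0 < N := K.det_frame_normSq_pos
  have hp : 0 < r * N := mul_pos hr hNpos
  -- Normalizes the determinant `s * (r * s) * N` to `1`.
  set s := (√(r * N))⁻¹ with hs
  have hspos : 0 < s := inv_pos.2 (Real.sqrt_pos.2 hp)
  refine ⟨⟨s • null K.src + (r * s) • null K.tgt,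
    K.posDef_combination hspos (mul_pos hr hspos), ?_⟩, s, hspos, rfl⟩
  have h1 : s * s * (r * N) = 1 := by
    have : √(r * N) * √(r * N) = r * N := Real.mul_self_sqrt hp.le
    have h0 : √(r * N) ≠ 0 := (Real.sqrt_pos.2 hp).ne'
    rw [← this, hs]
    field_simp
  rw [K.det_combination, ← hN, show s * (r * s) * N = s * s * (r * N) by ring, h1,
    Complex.ofReal_one]

/-! ### Perpendicular lines -/

/-- The factors `X.1` and its adjugate cancel, and the adjugate of a traceless matrix is its
negative; the result does not depend on `X`. -/
theorem Line.trace_tangent_mul_adjugate (K M : Line) (X : H3) :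
    ((K.invol * X.1) * (M.invol * X.1).adjugate).trace = -(K.invol * M.invol).trace := by
  have hM : M.invol.adjugate = -M.invol := by
    have h := apply_one_one_of_trace_eq_zero M.trace_invol
    rw [adjugate_fin_two]
    ext i j
    fin_cases i <;> fin_cases j <;> simp [h]
  have hX : X.1 * X.1.adjugate = 1 := by rw [mul_adjugate, X.2.2, one_smul]
  rw [adjugate_mul_distrib, hM, mul_neg, mul_neg, trace_neg, mul_assoc, ← mul_assoc X.1, hX,
    one_mul]

theorem Line.isPerpAt_iff (K M : Line) (X : H3) :
    K.IsPerpAt M X ↔ X ∈ K.points ∧ X ∈ M.points ∧ (K.invol * M.invol).trace = 0 := by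
  -- `minkowski` keeps only the real part of the trace; for Hermitian matrices nothing is lost.
  have him : ∀ {T U : Matrix (Fin 2) (Fin 2) ℂ}, T.IsHermitian → U.IsHermitian →
      (T * U.adjugate).trace.im = 0 := by
    intro T U hT hU
    have hU' : U.adjugate.IsHermitian := hU.adjugate
    rw [← Complex.conj_eq_iff_im, ← Complex.star_def, ← trace_conjTranspose, conjTranspose_mul,
      hT.eq, hU'.eq, trace_mul_comm]
  constructor
  · rintro ⟨T, U, hT, hU, h⟩
    refine ⟨hT.mem_points, hU.mem_points, ?_⟩
    obtain ⟨rfl, hT⟩ := (K.isTangentAt_iff _ _).1 hT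
    obtain ⟨rfl, hU⟩ := (M.isTangentAt_iff _ _).1 hU
    rw [← neg_eq_zero, ← K.trace_tangent_mul_adjugate M X]
    exact Complex.ext h (him hT hU)
  · rintro ⟨⟨s, t, hs, ht, hX⟩, ⟨s', t', hs', ht', hX'⟩, h⟩
    have hT : K.IsTangentAt X _ := ⟨s, t, hs, ht, hX, rfl⟩
    have hU : M.IsTangentAt X _ := ⟨s', t', hs', ht', hX', rfl⟩
    refine ⟨_, _, hT, hU, ?_⟩
    rw [((K.isTangentAt_iff _ _).1 hT).1, ((M.isTangentAt_iff _ _).1 hU).1, minkowski,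
      K.trace_tangent_mul_adjugate M X, h]
    simp

/-- Orthogonality over `ℂ` already forces the lines to meet. In the frame of `K`, the involution of
`M` is off-diagonal with entries `b` and `b⁻¹`; at the point of `K` with coefficient ratio `1 /
|b|²` the product `M.invol * X.1` is Hermitian, so this point lies on `M`. -/
theorem Line.isPerp_iff (K M : Line) : K.IsPerp M ↔ (K.invol * M.invol).trace = 0 := by
  constructor
  · rintro ⟨X, hX⟩
    exact ((K.isPerpAt_iff M X).1 hX).2.2
  · intro h
    set F := K.frame with hF
    have hFi : F * F⁻¹ = 1 := mul_nonsing_inv _ K.isUnit_det_frame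
    have hFi' : F⁻¹ * F = 1 := nonsing_inv_mul _ K.isUnit_det_frame
    set m := F⁻¹ * M.invol * F with hm
    have hMm : M.invol = F * m * F⁻¹ := by
      rw [hm]
      simp only [mul_assoc, hFi, mul_one]
      rw [← mul_assoc, hFi, one_mul]
    have htr : m.trace = 0 := by rw [hm, trace_mul_comm, ← mul_assoc, hFi, one_mul, M.trace_invol]
    have hdet : m.det = -1 := by
      rw [hm, det_mul, det_mul, det_nonsing_inv, mul_right_comm, Ring.inverse_mul_cancel _
        K.isUnit_det_frame, one_mul, M.det_invol]
    have htr2 : (diagonal ![-1, 1] * m).trace = 0 := by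
      have e : K.invol * M.invol = F * (diagonal ![-1, 1] * m) * F⁻¹ := by
        rw [Line.invol, ← hF, hMm]
        simp only [mul_assoc]
        rw [← mul_assoc F⁻¹ F, hFi', one_mul]
      rw [← h, e, trace_mul_comm _ F⁻¹, ← mul_assoc F⁻¹ F, hFi', one_mul]
    have h11 := apply_one_one_of_trace_eq_zero htr
    have h00 : m 0 0 = 0 := by
      rw [trace_fin_two] at htr2
      simpa [h11] using htr2
    have hbc : m 0 1 * m 1 0 = 1 := by
      rw [det_fin_two, h00] at hdet
      linear_combination -hdet
    have hb : m 0 1 ≠ 0 := left_ne_zero_of_mul_eq_one hbc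
    have hbn : 0 < Complex.normSq (m 0 1) := Complex.normSq_pos.2 hb
    obtain ⟨X, s, hs, hX⟩ := K.exists_point (inv_pos.2 hbn)
    refine ⟨X, (K.isPerpAt_iff M X).2 ⟨⟨s, _, hs, mul_pos (inv_pos.2 hbn) hs, hX⟩, ?_, h⟩⟩
    refine ((M.isTangentAt_iff X (M.invol * X.1)).2 ⟨rfl, ?_⟩).mem_points
    have hX' : X.1 = F * diagonal ![(s : ℂ), (((Complex.normSq (m 0 1))⁻¹ * s : ℝ) : ℂ)] * Fᴴ := by
      rw [hX, hF, K.frame_mul_diagonal_mul]; rfl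
    rw [hX', hMm]
    simp only [mul_assoc]
    rw [← mul_assoc F⁻¹, hFi', one_mul, ← mul_assoc m, ← mul_assoc F]
    apply isHermitian_mul_mul_conjTranspose
    have hc : m 1 0 = (m 0 1)⁻¹ := eq_inv_of_mul_eq_one_right hbc
    have hn : (Complex.normSq (m 0 1) : ℂ) = m 0 1 * star (m 0 1) := (Complex.mul_conj _).symm
    have hb' : (starRingEnd ℂ) (m 0 1) ≠ 0 := (map_ne_zero _).2 hb
    ext i j
    fin_cases i <;> fin_cases j
    · simp [h00]
    · simp [hc, hn]
      field_simp
    · simp [hc, hn]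
      field_simp
    · simp [h00, h11]

/-! ### Perpendiculars to axes -/

/-- A traceless matrix with nonzero square is a multiple of the involution of a line. -/
theorem exists_smul_invol_eq {S : Matrix (Fin 2) (Fin 2) ℂ} (htr : S.trace = 0)
    (hS : S * S ≠ 0) : ∃ (c : ℂ) (K : Line), c ≠ 0 ∧ S = c • K.invol := by
  obtain ⟨c, hc⟩ := IsAlgClosed.exists_eq_mul_self (-S.det)
  have hS2 := mul_self_of_trace_eq_zero htr
  rw [hc] at hS2
  have hc0 : c ≠ 0 := by
    rintro rfl
    exact hS (by rw [hS2]; simp)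
  obtain ⟨K, hK⟩ := exists_invol_eq (S := c⁻¹ • S) (by
    rw [smul_mul_smul_comm, hS2, smul_smul]
    field_simp
    rw [one_smul]) (by rw [trace_smul, htr, smul_zero])
  exact ⟨c, K, hc0, by rw [hK, smul_inv_smul₀ hc0]⟩

theorem eq_of_mulVec_homog_eq_zero {S : Matrix (Fin 2) (Fin 2) ℂ} (hS : S ≠ 0)
    {x y : OnePoint ℂ} (hx : S *ᵥ homog x = 0) (hy : S *ᵥ homog y = 0) : x = y := by
  by_contra h
  exact hS ((⟨x, y, h⟩ : Line).ext_mulVec (by rw [zero_mulVec]; exact hx)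
    (by rw [zero_mulVec]; exact hy))

theorem exists_mulVec_homog_eq_zero {S : Matrix (Fin 2) (Fin 2) ℂ} (hS : S ≠ 0)
    (h2 : S * S = 0) : ∃ u, S *ᵥ homog u = 0 := by
  obtain ⟨v, hv⟩ : ∃ v, S *ᵥ v ≠ 0 := by
    by_contra! h
    apply hS
    apply Matrix.ext_of_mulVec_single
    intro i
    rw [h, zero_mulVec]
  obtain ⟨u, c, hc, hu⟩ := exists_eq_smul_homog hv
  refine ⟨u, smul_right_injective _ hc ?_⟩
  dsimp only
  rw [← mulVec_smul, ← hu, mulVec_mulVec, h2, zero_mulVec, smul_zero]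

theorem Line.invol_mulVec_ne_zero (K : Line) {v : Fin 2 → ℂ} (hv : v ≠ 0) :
    K.invol *ᵥ v ≠ 0 := by
  intro h
  apply hv
  rw [← one_mulVec v, ← K.invol_mul_self, ← mulVec_mulVec, h, mulVec_zero]

/-- Here `S` anticommutes with `K.invol`, so `K.invol` preserves the one-dimensional kernel of `S`,
and `u` is an eigenvector of it. -/
theorem Line.eq_src_or_tgt_of_trace_eq_zero (K : Line) {S : Matrix (Fin 2) (Fin 2) ℂ}
    (hS : S ≠ 0) (htr : S.trace = 0) {u : OnePoint ℂ} (hu : S *ᵥ homog u = 0)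
    (h : (S * K.invol).trace = 0) : u = K.src ∨ u = K.tgt := by
  obtain ⟨x, c, hc, hx⟩ := exists_eq_smul_homog (K.invol_mulVec_ne_zero (homog_ne_zero u))
  have h1 : S *ᵥ homog x = 0 := by
    apply smul_right_injective _ hc
    dsimp only
    rw [← mulVec_smul, ← hx, mulVec_mulVec,
      mul_eq_neg_mul_of_trace_eq_zero htr K.trace_invol h, neg_mulVec, ← mulVec_mulVec, hu,
      mulVec_zero, neg_zero, smul_zero]
  rw [eq_of_mulVec_homog_eq_zero hS h1 hu] at hx
  exact K.eq_src_or_tgt_of_mulVec hx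

theorem fixedSet_mk_of_eq_add_nilpotent {g : SL(2, ℂ)} {S : Matrix (Fin 2) (Fin 2) ℂ} {a : ℂ}
    (hg : g.1 = a • 1 + S) (hS : S ≠ 0) (h2 : S * S = 0) {u : OnePoint ℂ}
    (hu : S *ᵥ homog u = 0) : fixedSet (QuotientGroup.mk g : PSL(2, ℂ)) = {u} := by
  ext x
  rw [fixedSet, Set.mem_ofPred_eq, mk_smul_eq_iff, hg, Set.mem_singleton_iff]
  constructor
  · rintro ⟨c, hc⟩
    rw [add_mulVec, smul_mulVec, one_mulVec] at hc
    have h1 : S *ᵥ homog x = (c - a) • homog x := by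
      rw [sub_smul, ← hc, add_sub_cancel_left]
    have h3 : ((c - a) * (c - a)) • homog x = 0 := by
      rw [mul_smul, ← h1, ← mulVec_smul, ← h1, mulVec_mulVec, h2, zero_mulVec]
    have h4 := mul_self_eq_zero.1 ((smul_eq_zero.1 h3).resolve_right (homog_ne_zero x))
    rw [h4, zero_smul] at h1
    exact eq_of_mulVec_homog_eq_zero hS h1 hu
  · rintro rfl
    exact ⟨a, by rw [add_mulVec, hu, smul_mulVec, one_mulVec, add_zero]⟩

/-- The traceless part of a `2 × 2` matrix. -/
noncomputable def tracelessPart (S : Matrix (Fin 2) (Fin 2) ℂ) : Matrix (Fin 2) (Fin 2) ℂ :=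
  S - (S.trace / 2) • 1

theorem trace_tracelessPart (S : Matrix (Fin 2) (Fin 2) ℂ) : (tracelessPart S).trace = 0 := by
  simp [tracelessPart]

theorem eq_add_tracelessPart (S : Matrix (Fin 2) (Fin 2) ℂ) :
    S = (S.trace / 2) • 1 + tracelessPart S := by
  simp [tracelessPart]

theorem trace_tracelessPart_mul (S : Matrix (Fin 2) (Fin 2) ℂ) {T : Matrix (Fin 2) (Fin 2) ℂ}
    (hT : T.trace = 0) : (tracelessPart S * T).trace = (S * T).trace := by
  simp [tracelessPart, sub_mul, hT]

/-- With a proper axis `N`, `g` is a combination of `1` and `N.invol`. With one fixed point `u`, the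
traceless part `S` kills `u`, and if `u` is an end of `K` then `S * K.invol = ±S`. -/
theorem trace_mul_invol_of_isPerpToAxis {g : SL(2, ℂ)} {K : Line}
    (h : IsPerpToAxis (QuotientGroup.mk g) K) : (g.1 * K.invol).trace = 0 := by
  rcases h with ⟨N, hN, hperp⟩ | ⟨u, hu, hK⟩
  · have h1 : N.src ∈ fixedSet (QuotientGroup.mk g : PSL(2, ℂ)) := by rw [hN]; simp
    have h2 : N.tgt ∈ fixedSet (QuotientGroup.mk g : PSL(2, ℂ)) := by rw [hN]; simp
    obtain ⟨a, ha⟩ := (mk_smul_eq_iff g _ _).1 h1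
    obtain ⟨b, hb⟩ := (mk_smul_eq_iff g _ _).1 h2
    have hg : g.1 = ((a + b) / 2) • 1 + ((b - a) / 2) • N.invol := by
      apply N.ext_mulVec
      · rw [ha, add_mulVec, smul_mulVec, smul_mulVec, N.invol_mulVec_src, one_mulVec]
        module
      · rw [hb, add_mulVec, smul_mulVec, smul_mulVec, N.invol_mulVec_tgt, one_mulVec]
        module
    have h3 := (K.isPerp_iff N).1 hperp
    rw [trace_mul_comm] at h3
    rw [hg, add_mul, trace_add, smul_mul_assoc, smul_mul_assoc, trace_smul, trace_smul, h3, one_mul,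
      K.trace_invol, smul_zero, smul_zero, add_zero]
  · rw [← trace_tracelessPart_mul _ K.trace_invol]
    set S := tracelessPart g.1 with hS
    have hg : g.1 = (g.1.trace / 2) • 1 + S := eq_add_tracelessPart _
    have htr : S.trace = 0 := trace_tracelessPart _
    by_cases h2 : S * S = 0
    · by_cases h0 : S = 0
      · rw [h0, zero_mul, trace_zero]
      obtain ⟨w, hw⟩ := exists_mulVec_homog_eq_zero h0 h2
      have hf := fixedSet_mk_of_eq_add_nilpotent hg h0 h2 hw
      rw [hu, Set.singleton_eq_singleton_iff] at hf
      subst hf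
      rcases hK with rfl | rfl
      · have : S * K.invol = S := by
          apply K.ext_mulVec
          · rw [← mulVec_mulVec, K.invol_mulVec_src, mulVec_neg, hw, neg_zero]
          · rw [← mulVec_mulVec, K.invol_mulVec_tgt]
        rw [this, htr]
      · have : S * K.invol = -S := by
          apply K.ext_mulVec
          · rw [← mulVec_mulVec, K.invol_mulVec_src, mulVec_neg, neg_mulVec]
          · rw [← mulVec_mulVec, K.invol_mulVec_tgt, neg_mulVec, hw, neg_zero]
        rw [this, trace_neg, htr, neg_zero]
    -- A traceless part with nonzero square would give two fixed points.
    · obtain ⟨c, M, hc, hM⟩ := exists_smul_invol_eq htr h2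
      rw [hM] at hg
      have hf := fixedSet_mk_of_eq_add_invol hc hg
      rw [hu] at hf
      have h3 : M.src ∈ ({u} : Set (OnePoint ℂ)) := by rw [hf]; simp
      have h4 : M.tgt ∈ ({u} : Set (OnePoint ℂ)) := by rw [hf]; simp
      exact absurd (h3.trans h4.symm) M.ne

/-- A non-scalar `g` has a nonzero traceless part: nilpotent in the parabolic case, otherwise a
multiple of the involution of the axis. -/
theorem isPerpToAxis_of_trace_mul_invol {g : SL(2, ℂ)} {K : Line}
    (hg0 : ∀ a : ℂ, g.1 ≠ a • 1) (h : (g.1 * K.invol).trace = 0) :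
    IsPerpToAxis (QuotientGroup.mk g) K := by
  rw [← trace_tracelessPart_mul _ K.trace_invol] at h
  set S := tracelessPart g.1 with hS
  have hg : g.1 = (g.1.trace / 2) • 1 + S := eq_add_tracelessPart _
  have htr : S.trace = 0 := trace_tracelessPart _
  have h0 : S ≠ 0 := by
    intro h0
    rw [h0, add_zero] at hg
    exact hg0 _ hg
  by_cases h2 : S * S = 0
  · obtain ⟨u, hu⟩ := exists_mulVec_homog_eq_zero h0 h2
    right
    refine ⟨u, fixedSet_mk_of_eq_add_nilpotent hg h0 h2 hu, ?_⟩
    exact (K.eq_src_or_tgt_of_trace_eq_zero h0 htr hu h).imp Eq.symm Eq.symm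
  · obtain ⟨c, M, hc, hM⟩ := exists_smul_invol_eq htr h2
    left
    rw [hM] at hg
    refine ⟨M, fixedSet_mk_of_eq_add_invol hc hg, ?_⟩
    rw [K.isPerp_iff, trace_mul_comm]
    rw [hM, smul_mul_assoc, trace_smul] at h
    exact (smul_eq_zero.1 h).resolve_left hc

/-! ### Planes -/

/-- The Hermitian form on homogeneous coordinates whose zero set is the horizon. -/
noncomputable def Plane.dual (P : Plane) : Matrix (Fin 2) (Fin 2) ℂ := P.normal.adjugate

theorem Plane.isHermitian_dual (P : Plane) : P.dual.IsHermitian := P.isHermitian.adjugate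

theorem Plane.det_dual_ne_zero (P : Plane) : P.dual.det ≠ 0 := by
  rw [Plane.dual, det_adjugate]
  intro h
  have := P.det_neg
  simp at h
  rw [h] at this
  simp at this

theorem trace_mul_adjugate_fin_two {R : Type*} [CommRing R] (S T : Matrix (Fin 2) (Fin 2) R) :
    (S * T.adjugate).trace = (S.adjugate * T).trace := by
  simp only [trace_fin_two, mul_apply, Fin.sum_univ_two]
  simp [adjugate_fin_two]
  ring

theorem Plane.minkowski_normal (P : Plane) (X : Matrix (Fin 2) (Fin 2) ℂ) :
    minkowski P.normal X = (P.dual * X).trace.re := by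
  rw [minkowski, trace_mul_adjugate_fin_two]
  rfl

theorem Plane.minkowski_add_smul (P : Plane) (s t : ℝ) (X Y : Matrix (Fin 2) (Fin 2) ℂ) :
    minkowski P.normal (s • X + t • Y) =
      s * minkowski P.normal X + t * minkowski P.normal Y := by
  simp only [P.minkowski_normal, mul_add, mul_smul_comm, trace_add, trace_smul, Complex.add_re,
    Complex.real_smul, Complex.re_ofReal_mul]

theorem Plane.form_eq (P : Plane) (z : OnePoint ℂ) :
    P.form z = (star (homog z) ⬝ᵥ (P.dual *ᵥ homog z)).re := by
  rw [Plane.form, P.minkowski_normal, null_eq_vecMulVec, mul_vecMulVec, trace_vecMulVec,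
    dotProduct_comm]

theorem Plane.dotProduct_dual_comm (P : Plane) (v w : Fin 2 → ℂ) :
    star (star v ⬝ᵥ (P.dual *ᵥ w)) = star w ⬝ᵥ (P.dual *ᵥ v) := by
  rw [star_dotProduct, star_star, star_mulVec, P.isHermitian_dual.eq, ← dotProduct_mulVec]

theorem Plane.ofReal_form (P : Plane) (z : OnePoint ℂ) :
    (P.form z : ℂ) = star (homog z) ⬝ᵥ (P.dual *ᵥ homog z) := by
  rw [P.form_eq]
  exact Complex.conj_eq_iff_re.1 (P.dotProduct_dual_comm _ _)

theorem Line.liesOn_iff (K : Line) (P : Plane) :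
    K.LiesOn P ↔ P.form K.src = 0 ∧ P.form K.tgt = 0 := by
  constructor
  · intro h
    have key : ∀ r : ℝ, 0 < r → P.form K.src + r * P.form K.tgt = 0 := by
      intro r hr
      obtain ⟨X, s, hs, hX⟩ := K.exists_point hr
      have h1 : X ∈ P.points := h ⟨s, r * s, hs, mul_pos hr hs, hX⟩
      rw [Plane.points, Set.mem_ofPred_eq, hX, P.minkowski_add_smul] at h1
      have h2 : s * (P.form K.src + r * P.form K.tgt) = 0 := by
        rw [← h1, Plane.form, Plane.form]; ring
      exact (mul_eq_zero.1 h2).resolve_left hs.ne'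
    have h1 := key 1 one_pos
    have h2 := key 2 two_pos
    constructor <;> linarith
  · rintro ⟨h1, h2⟩ X ⟨s, t, hs, ht, hX⟩
    rw [Plane.points, Set.mem_ofPred_eq, hX, P.minkowski_add_smul]
    rw [Plane.form] at h1 h2
    rw [h1, h2]
    ring

/-- In the frame of `K` the form of the plane has a matrix `G`, and the condition says that
`diag(-1, 1)` anticommutes with `G`, i.e. that the diagonal of `G` vanishes; its entries are the
values of the form at the two ends. This version is real-linear in the involution. -/
theorem Line.liesOn_iff_invol (K : Line) (P : Plane) :
    K.LiesOn P ↔ K.involᴴ * P.dual + P.dual * K.invol = 0 := by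
  set F := K.frame with hF
  set G := Fᴴ * P.dual * F with hG
  have hJF : K.invol * F = F * diagonal ![-1, 1] := by
    rw [Line.invol, nonsing_inv_mul_cancel_right _ _ K.isUnit_det_frame]
  have hFJ : Fᴴ * K.involᴴ = diagonal ![-1, 1] * Fᴴ := by
    rw [← conjTranspose_mul, hJF, conjTranspose_mul, diagonal_conjTranspose]
    congr 2
    ext i
    fin_cases i <;> simp
  have h1 : Fᴴ * (K.involᴴ * P.dual + P.dual * K.invol) * F =
      diagonal ![-1, 1] * G + G * diagonal ![-1, 1] := by
    rw [mul_add, add_mul, ← mul_assoc, hFJ, hG]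
    simp only [mul_assoc, hJF]
  have hu : IsUnit F := (isUnit_iff_isUnit_det _).2 K.isUnit_det_frame
  have h2 : K.involᴴ * P.dual + P.dual * K.invol = 0 ↔
      diagonal ![-1, 1] * G + G * diagonal ![-1, 1] = 0 := by
    rw [← h1]
    constructor
    · intro h
      rw [h, mul_zero, zero_mul]
    · intro h
      have hu' : IsUnit Fᴴ := hu.star
      rwa [hu.mul_left_eq_zero, hu'.mul_right_eq_zero] at h
  have h00 : G 0 0 = P.form K.src := by
    rw [P.ofReal_form, hG]
    simp [mul_apply, Fin.sum_univ_two, dotProduct, conjTranspose_apply, hF]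
    ring
  have h11 : G 1 1 = P.form K.tgt := by
    rw [P.ofReal_form, hG]
    simp [mul_apply, Fin.sum_univ_two, dotProduct, conjTranspose_apply, hF]
    ring
  rw [h2, K.liesOn_iff]
  constructor
  · rintro ⟨hs, ht⟩
    rw [hs, Complex.ofReal_zero] at h00
    rw [ht, Complex.ofReal_zero] at h11
    ext i j
    fin_cases i <;> fin_cases j <;> simp [h00, h11]
  · intro h
    have e0 := congrFun (congrFun h 0) 0
    have e1 := congrFun (congrFun h 1) 1
    simp [h00] at e0
    simp [h11] at e1
    constructor
    · linarith
    · linarith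

/-! ### Non-separating planes have no common perpendicular -/

theorem NotSeparating.symm {P Q R : Plane} (h : NotSeparating P Q R) : NotSeparating P R Q := by
  rwa [NotSeparating, Set.union_comm]

theorem DisjointOrTangent.symm {P Q : Plane} (h : DisjointOrTangent P Q) :
    DisjointOrTangent Q P := by
  rwa [DisjointOrTangent, Set.inter_comm]

theorem NotSeparating.exists_sign {P Q R : Plane} (h : NotSeparating P Q R) :
    ∃ σ : ℝ, σ ≠ 0 ∧ ∀ z ∈ Q.horizon ∪ R.horizon, 0 ≤ σ * P.form z := by
  rcases h with h | h
  · exact ⟨1, one_ne_zero, fun z hz => by simpa using h z hz⟩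
  · exact ⟨-1, by norm_num, fun z hz => by simpa using h z hz⟩

/-- The value at `X` is a positive combination of the nonnegative values at the two ends of `K`. If
it were zero, both ends would lie on both horizons, which share at most one point. -/
theorem pos_of_mem_points {P Q : Plane} (hPQ : DisjointOrTangent P Q) {σ : ℝ} (hσ : σ ≠ 0)
    (hQ : ∀ z ∈ Q.horizon, 0 ≤ σ * P.form z) {K : Line} (hK : K.LiesOn Q) {X : H3}
    (hX : X ∈ K.points) : 0 < σ * minkowski P.normal X.1 := by
  obtain ⟨s, t, hs, ht, hX⟩ := hX
  obtain ⟨h1, h2⟩ := (K.liesOn_iff Q).1 hK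
  have e : σ * minkowski P.normal X.1 = s * (σ * P.form K.src) + t * (σ * P.form K.tgt) := by
    rw [hX, P.minkowski_add_smul, Plane.form, Plane.form]
    ring
  have p1 := mul_nonneg hs.le (hQ _ h1)
  have p2 := mul_nonneg ht.le (hQ _ h2)
  rw [e]
  refine lt_of_le_of_ne (add_nonneg p1 p2) fun h0 => K.ne (hPQ ⟨?_, h1⟩ ⟨?_, h2⟩)
  · have : s * (σ * P.form K.src) = 0 := by linarith
    exact ((mul_eq_zero.1 ((mul_eq_zero.1 this).resolve_left hs.ne')).resolve_left hσ)
  · have : t * (σ * P.form K.tgt) = 0 := by linarith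
    exact ((mul_eq_zero.1 ((mul_eq_zero.1 this).resolve_left ht.ne')).resolve_left hσ)

/-- Of three vectors in the open quadrant, the one of intermediate slope is a nonnegative
combination of the others. -/
theorem exists_nonneg_combination {s₁ t₁ s₂ t₂ s₃ t₃ : ℝ} (h₁ : 0 < s₁) (h₂ : 0 < s₂)
    (h₃ : 0 < s₃) (h₁₂ : t₁ * s₂ ≤ t₂ * s₁) (h₂₃ : t₂ * s₃ ≤ t₃ * s₂) :
    ∃ α β : ℝ, 0 ≤ α ∧ 0 ≤ β ∧ s₂ = α * s₁ + β * s₃ ∧ t₂ = α * t₁ + β * t₃ := by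
  rcases eq_or_lt_of_le h₂₃ with h | h
  · exact ⟨0, s₂ / s₃, le_rfl, by positivity, by field_simp; ring, by field_simp; linarith⟩
  · have hd : 0 < t₃ * s₁ - t₁ * s₃ := by
      have e : (t₃ * s₁ - t₁ * s₃) * s₂ =
        (t₃ * s₂ - t₂ * s₃) * s₁ + (t₂ * s₁ - t₁ * s₂) * s₃ := by ring
      have : 0 < (t₃ * s₁ - t₁ * s₃) * s₂ := by
        rw [e]
        exact add_pos_of_pos_of_nonneg (mul_pos (sub_pos.2 h) h₁)
          (mul_nonneg (sub_nonneg.2 h₁₂) h₃.le)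
      exact pos_of_mul_pos_left this h₂.le
    refine ⟨(t₃ * s₂ - t₂ * s₃) / (t₃ * s₁ - t₁ * s₃), (t₂ * s₁ - t₁ * s₂) / (t₃ * s₁ - t₁ * s₃),
      div_nonneg (sub_nonneg.2 h.le) hd.le, div_nonneg (sub_nonneg.2 h₁₂) hd.le, ?_, ?_⟩ <;>
    · rw [div_mul_eq_mul_div, div_mul_eq_mul_div, ← add_div, eq_div_iff hd.ne']
      ring

/-- The middle point is a nonnegative combination of the outer ones, as Hermitian matrices. The form
of `P₂` has the same strict sign at the outer points and vanishes at the middle one, so both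
coefficients are zero, contradicting determinant `1`. -/
theorem false_of_ordered_points {P₁ P₂ P₃ : Plane} (h₂₁ : DisjointOrTangent P₂ P₁)
    (h₂₃ : DisjointOrTangent P₂ P₃) (hsep : NotSeparating P₂ P₁ P₃) {K₁ K₂ K₃ N : Line}
    (hK₁ : K₁.LiesOn P₁) (hK₂ : K₂.LiesOn P₂) (hK₃ : K₃.LiesOn P₃) {X₁ X₂ X₃ : H3}
    (hX₁ : X₁ ∈ K₁.points) (hX₂ : X₂ ∈ K₂.points) (hX₃ : X₃ ∈ K₃.points)
    {s₁ t₁ s₂ t₂ s₃ t₃ : ℝ} (p₁ : 0 < s₁) (p₂ : 0 < s₂) (p₃ : 0 < s₃)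
    (e₁ : X₁.1 = s₁ • null N.src + t₁ • null N.tgt)
    (e₂ : X₂.1 = s₂ • null N.src + t₂ • null N.tgt)
    (e₃ : X₃.1 = s₃ • null N.src + t₃ • null N.tgt)
    (le₁₂ : t₁ * s₂ ≤ t₂ * s₁) (le₂₃ : t₂ * s₃ ≤ t₃ * s₂) : False := by
  obtain ⟨σ, hσ, hs⟩ := hsep.exists_sign
  obtain ⟨α, β, hα, hβ, es, et⟩ := exists_nonneg_combination p₁ p₂ p₃ le₁₂ le₂₃
  have e : X₂.1 = α • X₁.1 + β • X₃.1 := by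
    rw [e₁, e₂, e₃, es, et]
    module
  have f₁ := pos_of_mem_points h₂₁ hσ (fun z hz => hs z (Or.inl hz)) hK₁ hX₁
  have f₃ := pos_of_mem_points h₂₃ hσ (fun z hz => hs z (Or.inr hz)) hK₃ hX₃
  have f₂ : minkowski P₂.normal X₂.1 = 0 := hK₂ hX₂
  rw [e, P₂.minkowski_add_smul] at f₂
  have f : α * (σ * minkowski P₂.normal X₁.1) + β * (σ * minkowski P₂.normal X₃.1) = 0 := by
    linear_combination σ * f₂
  have g₁ := mul_nonneg hα f₁.le
  have g₃ := mul_nonneg hβ f₃.le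
  have hα0 : α = 0 := (mul_eq_zero.1 (by linarith : α * (σ * _) = 0)).resolve_right f₁.ne'
  have hβ0 : β = 0 := (mul_eq_zero.1 (by linarith : β * (σ * _) = 0)).resolve_right f₃.ne'
  have hdet := X₂.2.2
  rw [e, hα0, hβ0] at hdet
  simp at hdet

theorem IsNsdcTriple.not_common_perp {PA P PB : Plane} (h : IsNsdcTriple PA P PB)
    {KA K KB N : Line} (hKA : KA.LiesOn PA) (hK : K.LiesOn P) (hKB : KB.LiesOn PB)
    (pA : N.IsPerp KA) (p : N.IsPerp K) (pB : N.IsPerp KB) : False := by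
  obtain ⟨h1, h2, h3, s1, s2, s3⟩ := h
  obtain ⟨XA, hA⟩ := pA
  obtain ⟨X, hX⟩ := p
  obtain ⟨XB, hB⟩ := pB
  obtain ⟨⟨a, a', ha, ha', eA⟩, hA', -⟩ := (N.isPerpAt_iff _ _).1 hA
  obtain ⟨⟨c, c', hc, hc', e⟩, hX', -⟩ := (N.isPerpAt_iff _ _).1 hX
  obtain ⟨⟨b, b', hb, hb', eB⟩, hB', -⟩ := (N.isPerpAt_iff _ _).1 hB
  -- The three feet on `N` are ordered by the ratio of their coefficients, and the middle one gives
  -- the contradiction. The two cyclic cases only occur with equal ratios, where any two of the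
  -- inequalities serve.
  rcases le_total (a' * c) (c' * a) with l1 | l1 <;>
  rcases le_total (a' * b) (b' * a) with l2 | l2 <;>
  rcases le_total (c' * b) (b' * c) with l3 | l3
  · exact false_of_ordered_points h1.symm h2 s2 hKA hK hKB hA' hX' hB' ha hc hb eA e eB l1 l3
  · exact false_of_ordered_points h3.symm h2.symm s3 hKA hKB hK hA' hB' hX' ha hb hc eA eB e l2 l3
  · exact false_of_ordered_points h1.symm h2 s2 hKA hK hKB hA' hX' hB' ha hc hb eA e eB l1 l3
  · exact false_of_ordered_points h3 h1 s1.symm hKB hKA hK hB' hA' hX' hb ha hc eB eA e l2 l1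
  · exact false_of_ordered_points h1 h3 s1 hK hKA hKB hX' hA' hB' hc ha hb e eA eB l1 l2
  · exact false_of_ordered_points h2 h1.symm s2.symm hKB hK hKA hB' hX' hA' hb hc ha eB e eA l3 l1
  · exact false_of_ordered_points h2.symm h3.symm s3.symm hK hKB hKA hX' hB' hA' hc hb ha e eB eA
      l3 l2
  · exact false_of_ordered_points h2 h1.symm s2.symm hKB hK hKA hB' hX' hA' hb hc ha eB e eA l3 l1

/-- Three real affine functions on the plane with pairwise disjoint zero lines: one of the three
lines separates the other two. -/
theorem false_of_three_parallel_lines {β : Fin 3 → ℂ} {c : Fin 3 → ℝ} (hβ : ∀ i, β i ≠ 0)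
    (hdisj : ∀ i j, i ≠ j → ∀ z, (β i * z).re + c i = 0 → (β j * z).re + c j = 0 → False)
    (hsep : ∀ i j k, i ≠ j → i ≠ k → j ≠ k → ∃ σ : ℝ, σ ≠ 0 ∧ ∀ z,
      (β j * z).re + c j = 0 ∨ (β k * z).re + c k = 0 → 0 ≤ σ * ((β i * z).re + c i)) : False := by
  set n : ℝ := Complex.normSq (β 0) with hn
  have hn0 : n ≠ 0 := (Complex.normSq_pos.2 (hβ 0)).ne'
  have hbb : β 0 * (starRingEnd ℂ) (β 0) = n := Complex.mul_conj _
  have hr : ∀ i, ∃ r : ℝ, r ≠ 0 ∧ β i = r * β 0 := by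
    intro i
    have him : (β i * (starRingEnd ℂ) (β 0)).im = 0 := by
      by_contra him
      have hi : (0 : Fin 3) ≠ i := by
        rintro rfl
        rw [hbb] at him
        simp at him
      set w := β i * (starRingEnd ℂ) (β 0) with hw
      -- The intersection point of the lines `0` and `i` when they are not parallel: in units of
      -- `conj (β 0)`, the real part solves the first equation and the imaginary part the second.
      refine hdisj 0 i hi ((((-c 0 / n : ℝ) : ℂ) +
        ((((-c 0 / n) * w.re + c i) / w.im : ℝ) : ℂ) * Complex.I) * (starRingEnd ℂ) (β 0)) ?_ ?_
      · rw [mul_left_comm, hbb]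
        simp
        field_simp
        ring
      · rw [mul_left_comm, ← hw]
        simp
        field_simp
        ring
    refine ⟨(β i * (starRingEnd ℂ) (β 0)).re / n, ?_, ?_⟩
    · intro h
      have hz : β i * (starRingEnd ℂ) (β 0) = 0 :=
        Complex.ext ((div_eq_zero_iff.1 h).resolve_right hn0) him
      rcases mul_eq_zero.1 hz with h | h
      · exact hβ i h
      · exact hβ 0 ((map_eq_zero _).1 h)
    · have hre : (((β i * (starRingEnd ℂ) (β 0)).re : ℝ) : ℂ) = β i * (starRingEnd ℂ) (β 0) :=
        Complex.ext rfl (by simpa using him.symm)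
      have hnC : (n : ℂ) ≠ 0 := by exact_mod_cast hn0
      rw [Complex.ofReal_div, hre]
      field_simp
      rw [← hbb]
      ring
  choose r hr0 hr using hr
  -- The position of each line along the common normal direction.
  set h : Fin 3 → ℝ := fun i => -c i / r i with hh
  have hval : ∀ i x, (β i * ((x / n : ℝ) * (starRingEnd ℂ) (β 0))).re + c i =
      r i * (x - h i) := by
    intro i x
    rw [hr i, show (r i : ℂ) * β 0 * ((x / n : ℝ) * (starRingEnd ℂ) (β 0)) =
      (r i * (x / n) : ℝ) * (β 0 * (starRingEnd ℂ) (β 0)) by push_cast; ring, hbb]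
    have := hr0 i
    rw [← Complex.ofReal_mul, Complex.ofReal_re, hh]
    field_simp
    ring
  have hne : ∀ i j, i ≠ j → h i ≠ h j := by
    intro i j hij e
    refine hdisj i j hij _ ((hval i (h i)).trans ?_) ((hval j (h i)).trans ?_)
    · ring
    · rw [e]; ring
  have hpos : ∀ i j k, i ≠ j → i ≠ k → j ≠ k → 0 < (h j - h i) * (h k - h i) := by
    intro i j k hij hik hjk
    obtain ⟨σ, hσ, hs⟩ := hsep i j k hij hik hjk
    have s1 := hs _ (Or.inl ((hval j (h j)).trans (by ring)))
    have s2 := hs _ (Or.inr ((hval k (h k)).trans (by ring)))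
    rw [hval] at s1 s2
    have s3 := mul_nonneg s1 s2
    have hq : 0 < (σ * r i) ^ 2 := by
      have := mul_ne_zero hσ (hr0 i)
      positivity
    have s4 : 0 ≤ (σ * r i) ^ 2 * ((h j - h i) * (h k - h i)) := by
      calc 0 ≤ _ := s3
        _ = _ := by ring
    refine lt_of_le_of_ne (nonneg_of_mul_nonneg_right s4 hq) (Ne.symm ?_)
    exact mul_ne_zero (sub_ne_zero.2 (hne j i hij.symm)) (sub_ne_zero.2 (hne k i hik.symm))
  -- None of the three positions lies between the other two, which is impossible for distinct reals.
  have a0 := hpos 0 1 2 (by decide) (by decide) (by decide)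
  have a1 := hpos 1 0 2 (by decide) (by decide) (by decide)
  have a2 := hpos 2 0 1 (by decide) (by decide) (by decide)
  rcases lt_or_gt_of_ne (hne 0 1 (by decide)) with h01 | h01 <;> nlinarith

/-- In an affine coordinate centered at a point `u` of the horizon, the form of a plane is a real
affine function. -/
theorem Plane.exists_affine_form (P : Plane) {N : Line} (hu : P.form N.src = 0) :
    ∃ (β : ℂ) (c : ℝ), β ≠ 0 ∧ ∀ (z : ℂ) (x : OnePoint ℂ) (k : ℂ),
      z • homog N.src + homog N.tgt = k • homog x →
        (β * z).re + c = Complex.normSq k * P.form x := by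
  set β := star (homog N.tgt) ⬝ᵥ (P.dual *ᵥ homog N.src) with hβ
  have hu' : star (homog N.src) ⬝ᵥ (P.dual *ᵥ homog N.src) = 0 := by
    rw [← P.ofReal_form, hu, Complex.ofReal_zero]
  have hconj : star (homog N.src) ⬝ᵥ (P.dual *ᵥ homog N.tgt) = (starRingEnd ℂ) β :=
    (P.dotProduct_dual_comm _ _).symm
  refine ⟨2 * β, P.form N.tgt, ?_, ?_⟩
  · intro h0
    have h0 : β = 0 := by simpa using h0
    have hz : P.dual *ᵥ homog N.src = 0 := by
      have h1 : ∀ v : Fin 2 → ℂ, star v ⬝ᵥ (P.dual *ᵥ homog N.src) = 0 := by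
        intro v
        obtain ⟨a, b, rfl⟩ := N.exists_combination v
        rw [star_add, star_smul, star_smul, add_dotProduct, smul_dotProduct, smul_dotProduct, hu',
          ← hβ, h0, smul_zero, smul_zero, add_zero]
      exact dotProduct_star_self_eq_zero.1 (h1 (P.dual *ᵥ homog N.src))
    exact homog_ne_zero _ (Matrix.eq_zero_of_mulVec_eq_zero P.det_dual_ne_zero hz)
  · intro z x k hx
    have e : star (k • homog x) ⬝ᵥ (P.dual *ᵥ (k • homog x)) =
        ((Complex.normSq k * P.form x : ℝ) : ℂ) := by
      rw [star_smul, mulVec_smul, smul_dotProduct, dotProduct_smul, ← P.ofReal_form,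
        Complex.ofReal_mul, ← Complex.mul_conj]
      simp
      ring
    rw [← hx, star_add, star_smul, mulVec_add, mulVec_smul, add_dotProduct, dotProduct_add,
      dotProduct_add, smul_dotProduct, smul_dotProduct, dotProduct_smul, dotProduct_smul, hu',
      hconj, ← hβ, ← P.ofReal_form] at e
    have := congrArg Complex.re e
    rw [Complex.ofReal_re] at this
    rw [← this]
    simp
    ring

/-- Sending `u` to infinity turns the three horizons into straight lines. The horizons meet only at
`u`, so the lines are disjoint in the plane. -/
theorem false_of_common_point {Q : Fin 3 → Plane} {u : OnePoint ℂ} (hu : ∀ i, (Q i).form u = 0)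
    (hdisj : ∀ i j, i ≠ j → DisjointOrTangent (Q i) (Q j))
    (hsep : ∀ i j k, i ≠ j → i ≠ k → j ≠ k → NotSeparating (Q i) (Q j) (Q k)) : False := by
  obtain ⟨w, hw⟩ : ∃ w, u ≠ w := by
    by_cases h : u = ∞
    · exact ⟨(0 : ℂ), by rw [h]; exact OnePoint.infty_ne_coe 0⟩
    · exact ⟨∞, h⟩
  set N : Line := ⟨u, w, hw⟩ with hN
  choose β c hβ hform using fun i => (Q i).exists_affine_form (N := N) (hu i)
  have hpt : ∀ z : ℂ, ∃ (x : OnePoint ℂ) (k : ℂ), x ≠ u ∧ 0 < Complex.normSq k ∧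
      z • homog N.src + homog N.tgt = k • homog x := by
    intro z
    have h0 : z • homog N.src + homog N.tgt ≠ 0 := by
      intro h
      have := N.combination_eq_zero (a := z) (b := 1) (by rw [one_smul]; exact h)
      exact one_ne_zero this.2
    obtain ⟨x, k, hk, hx⟩ := exists_eq_smul_homog h0
    refine ⟨x, k, ?_, Complex.normSq_pos.2 hk, hx⟩
    rintro rfl
    have := N.combination_eq_zero (a := z - k) (b := 1) (by
      rw [one_smul, sub_smul, sub_add_eq_add_sub, sub_eq_zero]; exact hx)
    exact one_ne_zero this.2
  refine false_of_three_parallel_lines (c := c) hβ ?_ ?_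
  · intro i j hij z h1 h2
    obtain ⟨x, k, hxu, hk, hx⟩ := hpt z
    rw [hform _ z x k hx] at h1 h2
    exact hxu (hdisj i j hij ⟨(mul_eq_zero.1 h1).resolve_left hk.ne',
      (mul_eq_zero.1 h2).resolve_left hk.ne'⟩ ⟨hu i, hu j⟩)
  · intro i j k hij hik hjk
    obtain ⟨σ, hσ, hs⟩ := (hsep i j k hij hik hjk).exists_sign
    refine ⟨σ, hσ, fun z hz => ?_⟩
    obtain ⟨x, κ, hxu, hκ, hx⟩ := hpt z
    rw [hform _ z x κ hx, hform _ z x κ hx] at hz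
    rw [hform _ z x κ hx, mul_left_comm]
    exact mul_nonneg hκ.le (hs x (hz.imp (fun h => (mul_eq_zero.1 h).resolve_left hκ.ne')
      (fun h => (mul_eq_zero.1 h).resolve_left hκ.ne')))

theorem IsNsdcTriple.not_common_point {PA P PB : Plane} (h : IsNsdcTriple PA P PB)
    {u : OnePoint ℂ} (hA : PA.form u = 0) (hP : P.form u = 0) (hB : PB.form u = 0) : False := by
  obtain ⟨h1, h2, h3, s1, s2, s3⟩ := h
  refine false_of_common_point (Q := ![PA, P, PB]) (u := u) ?_ ?_ ?_
  · intro i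
    fin_cases i <;> simpa
  · intro i j hij
    fin_cases i <;> fin_cases j <;>
      first
        | exact absurd rfl hij
        | (simp; with_reducible assumption)
        | (simp; with_reducible exact DisjointOrTangent.symm (by assumption))
  · intro i j k hij hik hjk
    fin_cases i <;> fin_cases j <;> fin_cases k <;>
      first
        | exact absurd rfl hij
        | exact absurd rfl hik
        | exact absurd rfl hjk
        | (simp; with_reducible assumption)
        | (simp; with_reducible exact NotSeparating.symm (by assumption))

theorem Line.LiesOn.form_eq_zero {K : Line} {P : Plane} (h : K.LiesOn P) {u : OnePoint ℂ}
    (hu : u = K.src ∨ u = K.tgt) : P.form u = 0 := by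
  obtain ⟨h1, h2⟩ := (K.liesOn_iff P).1 h
  rcases hu with rfl | rfl
  · exact h1
  · exact h2

/-- Lines on the planes of an nsdc triple have linearly independent involutions. -/
theorem IsNsdcTriple.eq_zero_of_trace_eq_zero {PA P PB : Plane} (h : IsNsdcTriple PA P PB)
    {KA K KB : Line} (hKA : KA.LiesOn PA) (hK : K.LiesOn P) (hKB : KB.LiesOn PB)
    {S : Matrix (Fin 2) (Fin 2) ℂ} (hS : S.trace = 0) (tA : (S * KA.invol).trace = 0)
    (t : (S * K.invol).trace = 0) (tB : (S * KB.invol).trace = 0) : S = 0 := by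
  by_contra h0
  -- A nonzero nilpotent `S` would give a common end of the three lines, and any other nonzero `S` a
  -- common perpendicular.
  by_cases h2 : S * S = 0
  · obtain ⟨u, hu⟩ := exists_mulVec_homog_eq_zero h0 h2
    exact h.not_common_point
      (hKA.form_eq_zero (KA.eq_src_or_tgt_of_trace_eq_zero h0 hS hu tA))
      (hK.form_eq_zero (K.eq_src_or_tgt_of_trace_eq_zero h0 hS hu t))
      (hKB.form_eq_zero (KB.eq_src_or_tgt_of_trace_eq_zero h0 hS hu tB))
  · obtain ⟨c, N, hc, rfl⟩ := exists_smul_invol_eq hS h2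
    have key : ∀ M : Line, ((c • N.invol) * M.invol).trace = 0 → N.IsPerp M := by
      intro M hM
      rw [smul_mul_assoc, trace_smul] at hM
      exact (N.isPerp_iff M).2 ((smul_eq_zero.1 hM).resolve_left hc)
    exact h.not_common_perp hKA hK hKB (key _ tA) (key _ t) (key _ tB)

/-! ### The ortho-end of a triple of lines -/

theorem Line.ends_eq_of_invol_eq_smul {K M : Line} {c : ℂ} (h : K.invol = c • M.invol) :
    ({K.src, K.tgt} : Set (OnePoint ℂ)) = {M.src, M.tgt} := by
  rw [K.ends_eq_iff]
  have h1 := K.invol_mul_self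
  rw [h, smul_mul_smul_comm, M.invol_mul_self] at h1
  have h2 : c * c = 1 := by simpa using congrFun (congrFun h1 0) 0
  rcases mul_self_eq_one_iff.1 h2 with rfl | rfl
  · left; rw [h, one_smul]
  · right; rw [h, neg_one_smul]

theorem Line.ends_ne {K M : Line} {P Q : Plane} (hPQ : DisjointOrTangent P Q) (hK : K.LiesOn P)
    (hM : M.LiesOn Q) : ({K.src, K.tgt} : Set (OnePoint ℂ)) ≠ {M.src, M.tgt} := by
  intro h
  have hs : K.src ∈ ({M.src, M.tgt} : Set (OnePoint ℂ)) := by rw [← h]; simp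
  have ht : K.tgt ∈ ({M.src, M.tgt} : Set (OnePoint ℂ)) := by rw [← h]; simp
  exact K.ne (hPQ ⟨hK.form_eq_zero (Or.inl rfl), hM.form_eq_zero hs⟩
    ⟨hK.form_eq_zero (Or.inr rfl), hM.form_eq_zero ht⟩)

theorem halfTurn_mul_halfTurn (K M : Line) :
    halfTurn K * halfTurn M = QuotientGroup.mk (halfTurnSL K * halfTurnSL M) := by
  rw [halfTurn_eq, halfTurn_eq]
  rfl

theorem halfTurnSL_mul (K M : Line) :
    (halfTurnSL K * halfTurnSL M).1 = -(K.invol * M.invol) := by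
  show (Complex.I • K.invol) * (Complex.I • M.invol) = _
  rw [smul_mul_smul_comm, Complex.I_mul_I, neg_one_smul]

/-- The trace condition reduces to that of `K.invol * M.invol * M.invol = K.invol`. The product is
not scalar, since otherwise the two lines would have the same ends. -/
theorem isPerpToAxis_halfTurn_mul {K M : Line} {P Q : Plane} (hPQ : DisjointOrTangent P Q)
    (hK : K.LiesOn P) (hM : M.LiesOn Q) : IsPerpToAxis (halfTurn K * halfTurn M) M := by
  rw [halfTurn_mul_halfTurn]
  apply isPerpToAxis_of_trace_mul_invol
  · intro a ha
    rw [halfTurnSL_mul] at ha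
    refine Line.ends_ne hPQ hK hM (Line.ends_eq_of_invol_eq_smul (c := -a) ?_)
    rw [← mul_one K.invol, ← M.invol_mul_self, ← mul_assoc, neg_smul, ← one_mul M.invol,
      ← smul_mul_assoc, ← ha, neg_mul, neg_neg, one_mul]
  · rw [halfTurnSL_mul, neg_mul, mul_assoc, M.invol_mul_self, mul_one, trace_neg, K.trace_invol,
      neg_zero]

/-- For traceless `T`, `U` the commutator is `2TU` minus a scalar, so the trace is twice that of
`STU`. -/
theorem trace_mul_commutator {S T U : Matrix (Fin 2) (Fin 2) ℂ} (hS : S.trace = 0)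
    (hT : T.trace = 0) (hU : U.trace = 0) (h : (S * T * U).trace = 0) :
    ((T * U - U * T) * S).trace = 0 := by
  have e : U * T = (T * U).trace • 1 - T * U := by
    rw [← mul_add_mul_of_trace_eq_zero hT hU, add_sub_cancel_left]
  rw [e, sub_sub_eq_add_sub, sub_mul, add_mul, smul_mul_assoc, one_mul, trace_sub, trace_add,
    trace_smul, hS, trace_mul_comm (T * U), ← mul_assoc, h]
  simp

/-- If `M` is perpendicular to both axes, the commutator of `K.invol` and `M.invol` is
trace-orthogonal to `KA.invol` and `KB.invol`, and in any case to `K.invol`. By independence it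
vanishes, so `M.invol` is a multiple of `K.invol`. -/
theorem IsNsdcTriple.isOrthoEnd {PA P PB : Plane} (h : IsNsdcTriple PA P PB)
    {KA K KB : Line} (hKA : KA.LiesOn PA) (hK : K.LiesOn P) (hKB : KB.LiesOn PB) :
    IsOrthoEnd (halfTurn KA * halfTurn K) (halfTurn KB * halfTurn K) KA K KB := by
  refine ⟨⟨isPerpToAxis_halfTurn_mul h.1 hKA hK, isPerpToAxis_halfTurn_mul h.2.1.symm hKB hK, ?_⟩,
    rfl, rfl⟩
  intro M hA hB
  rw [halfTurn_mul_halfTurn] at hA hB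
  have tA := trace_mul_invol_of_isPerpToAxis hA
  have tB := trace_mul_invol_of_isPerpToAxis hB
  rw [halfTurnSL_mul, neg_mul, trace_neg, neg_eq_zero] at tA tB
  have h0 : K.invol * M.invol - M.invol * K.invol = 0 := by
    refine h.eq_zero_of_trace_eq_zero hKA hK hKB ?_ ?_ ?_ ?_
    · rw [trace_sub, trace_mul_comm, sub_self]
    · exact trace_mul_commutator KA.trace_invol K.trace_invol M.trace_invol tA
    · rw [sub_mul, mul_assoc, mul_assoc, K.invol_mul_self, mul_one, trace_sub, trace_mul_comm,
        mul_assoc, K.invol_mul_self, mul_one, sub_self]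
    · exact trace_mul_commutator KB.trace_invol K.trace_invol M.trace_invol tB
  have h1 := mul_add_mul_of_trace_eq_zero K.trace_invol M.trace_invol
  refine Line.ends_eq_of_invol_eq_smul (c := (K.invol * M.invol).trace / 2) ?_
  have h2 : K.invol * M.invol = ((K.invol * M.invol).trace / 2) • 1 := by
    rw [div_eq_inv_mul, mul_smul, ← h1, ← sub_eq_zero.1 h0]
    module
  calc M.invol = K.invol * (K.invol * M.invol) := by
        rw [← mul_assoc, K.invol_mul_self, one_mul]
    _ = _ := by rw [h2, mul_smul_comm, mul_one]; simp

theorem IsNsdcGroupOn.of_liesOn {PA P PB : Plane} (h : IsNsdcTriple PA P PB)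
    {KA K KB : Line} (hKA : KA.LiesOn PA) (hK : K.LiesOn P) (hKB : KB.LiesOn PB) :
    IsNsdcGroupOn PA P PB (markedGroup KA K KB).1 (markedGroup KA K KB).2 KA K KB :=
  ⟨h, h.isOrthoEnd hKA hK hKB, hKA, hK, hKB⟩

/-- The marked group determines the three lines up to orientation. -/
theorem IsNsdcTriple.markedGroup_eq_iff {PA P PB : Plane} (h : IsNsdcTriple PA P PB)
    {KA K KB MA M MB : Line} (hKA : KA.LiesOn PA) (hK : K.LiesOn P) (hKB : KB.LiesOn PB)
    (hMA : MA.LiesOn PA) (hM : M.LiesOn P) (hMB : MB.LiesOn PB) :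
    markedGroup KA K KB = markedGroup MA M MB ↔
      halfTurn KA = halfTurn MA ∧ halfTurn K = halfTurn M ∧ halfTurn KB = halfTurn MB := by
  constructor
  · intro e
    obtain ⟨e1, e2⟩ := Prod.mk.inj e
    have o1 := (h.isOrthoEnd hKA hK hKB).1
    have o2 := (h.isOrthoEnd hMA hM hMB).1
    have e3 : halfTurn K = halfTurn M := by
      rw [halfTurn_eq_halfTurn_iff, ← Line.ends_eq_iff]
      exact o2.2.2 K (by rw [← e1]; exact o1.1) (by rw [← e2]; exact o1.2.1)
    rw [e3] at e1 e2
    exact ⟨mul_right_cancel e1, e3, mul_right_cancel e2⟩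
  · rintro ⟨e1, e2, e3⟩
    rw [markedGroup, markedGroup, e1, e2, e3]

/-! ### The moves -/

/-- Three lines through a point that are pairwise perpendicular: their involutions satisfy the
relations of the Pauli matrices, up to a sign `ε`. -/
structure PauliTriple (V M K : Line) (ε : ℝ) : Prop where
  sq : ε * ε = 1
  anticomm : V.invol * K.invol = -(K.invol * V.invol)
  eq : M.invol = (ε * Complex.I) • (V.invol * K.invol)

/-- The product `m v k` commutes with `v` and `k`, hence is a scalar `c`; comparing squares gives
`c² = -1`, and the choice of root is the sign `ε`. -/
theorem exists_pauliTriple {V M K : Line} (hVK : (V.invol * K.invol).trace = 0)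
    (hVM : (V.invol * M.invol).trace = 0) (hMK : (M.invol * K.invol).trace = 0) :
    ∃ ε, PauliTriple V M K ε := by
  have aVK := mul_eq_neg_mul_of_trace_eq_zero V.trace_invol K.trace_invol hVK
  have aVM := mul_eq_neg_mul_of_trace_eq_zero V.trace_invol M.trace_invol hVM
  have aMK := mul_eq_neg_mul_of_trace_eq_zero M.trace_invol K.trace_invol hMK
  set v := V.invol with hv
  set m := M.invol with hm
  set k := K.invol with hk
  have hvv : v * v = 1 := V.invol_mul_self
  have hkk : k * k = 1 := K.invol_mul_self
  have hmm : m * m = 1 := M.invol_mul_self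
  set S := m * (v * k) with hS
  have hSv : S * v = v * S := by
    calc m * (v * k) * v = m * v * (k * v) := by simp only [mul_assoc]
      _ = -(v * m) * (-(v * k)) := by rw [aVK, aVM, neg_neg, neg_neg]
      _ = v * (m * (v * k)) := by simp only [mul_assoc, neg_mul_neg]
  have hSk : S * k = k * S := by
    calc m * (v * k) * k = m * (v * k * k) := by simp only [mul_assoc]
      _ = -(m * k * v * k) := by rw [aVK, neg_mul, mul_neg]; simp only [mul_assoc]
      _ = k * (m * (v * k)) := by rw [aMK]; simp only [mul_assoc, neg_mul, neg_neg]
  obtain ⟨c, hc⟩ : ∃ c : ℂ, S = c • 1 := by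
    have e := eq_add_tracelessPart S
    set T := tracelessPart S with hT
    have hTt : T.trace = 0 := trace_tracelessPart S
    have cT : ∀ x, S * x = x * S → T * x = x * T := by
      intro x hx
      rw [hT, tracelessPart, sub_mul, mul_sub, hx, smul_mul_assoc, mul_smul_comm, one_mul, mul_one]
    refine ⟨S.trace / 2, ?_⟩
    -- A traceless matrix commuting with a traceless involution is a multiple of it. Being a
    -- multiple of both `v` and `k`, which are orthogonal, `T` is zero.
    have key : ∀ x : Matrix (Fin 2) (Fin 2) ℂ, x.trace = 0 → x * x = 1 → T * x = x * T →
        T = ((T * x).trace / 2) • x := by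
      intro x hx hxx hTx
      have h1 := mul_add_mul_of_trace_eq_zero hTt hx
      rw [← hTx] at h1
      calc T = T * x * x := by rw [mul_assoc, hxx, mul_one]
        _ = ((1 / 2 : ℂ) • (T * x + T * x)) * x := by congr 1; module
        _ = _ := by rw [h1, smul_mul_assoc, smul_mul_assoc, one_mul, smul_smul]; congr 1; ring
    have h1 := key v V.trace_invol hvv (cT v hSv)
    have h2 : (T * k).trace = 0 := by
      rw [h1, smul_mul_assoc, trace_smul, hVK, smul_zero]
    have h3 := key k K.trace_invol hkk (cT k hSk)
    rw [h2, zero_div, zero_smul] at h3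
    rw [e, h3, add_zero]
    simp
  have hvk : v * k = c • m := by
    rw [← one_mul (v * k), ← hmm, mul_assoc, ← hS, hc, mul_smul_comm, mul_one]
  have hc2 : c * c = -1 := by
    have h1 : (v * k) * (v * k) = -1 := by
      calc (v * k) * (v * k) = v * k * v * k := by simp only [mul_assoc]
        _ = -(k * (v * v) * k) := by rw [aVK]; simp only [mul_assoc, neg_mul]
        _ = -1 := by rw [hvv, mul_one, hkk]
    rw [hvk, smul_mul_smul_comm, hmm] at h1
    simpa using congrFun (congrFun h1 0) 0
  have hm' : m = (-c) • (v * k) := by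
    rw [hvk, smul_smul, neg_mul, hc2, neg_neg, one_smul]
  have h0 : (c - Complex.I) * (c + Complex.I) = 0 := by
    linear_combination hc2 - Complex.I_mul_I
  rcases mul_eq_zero.1 h0 with h | h
  · refine ⟨-1, by norm_num, aVK, ?_⟩
    rw [← hm, hm', sub_eq_zero.1 h, Complex.ofReal_neg, Complex.ofReal_one, neg_one_mul]
  · refine ⟨1, by norm_num, aVK, ?_⟩
    rw [← hm, hm', eq_neg_of_add_eq_zero_left h, neg_neg, Complex.ofReal_one, one_mul]

theorem coe_inv_screwSL (V : Line) (c : ℂ) : ((screwSL V c)⁻¹).1 =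
    Complex.cosh (c / 2) • 1 - Complex.sinh (c / 2) • V.invol := by
  have h1 : (screwSL V c).1 * (Complex.cosh (c / 2) • 1 - Complex.sinh (c / 2) • V.invol) = 1 := by
    show screwMatrix V c * _ = 1
    have hs := Complex.cosh_sq_sub_sinh_sq (c / 2)
    rw [screwMatrix_eq, add_mul, mul_sub, mul_sub]
    simp only [smul_mul_smul_comm, one_mul, mul_one, V.invol_mul_self]
    calc _ = (Complex.cosh (c / 2) ^ 2 - Complex.sinh (c / 2) ^ 2) •
          (1 : Matrix (Fin 2) (Fin 2) ℂ) := by module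
      _ = 1 := by rw [hs, one_smul]
  have h2 : ((screwSL V c)⁻¹).1 * (screwSL V c).1 = 1 := by
    rw [← Matrix.SpecialLinearGroup.coe_mul, inv_mul_cancel]; rfl
  calc ((screwSL V c)⁻¹).1 = ((screwSL V c)⁻¹).1 * ((screwSL V c).1 *
        (Complex.cosh (c / 2) • 1 - Complex.sinh (c / 2) • V.invol)) := by rw [h1, mul_one]
    _ = _ := by rw [← mul_assoc, h2, one_mul]

/-- Moving the right factor of the conjugation across `K.invol` inverts it, so conjugation by `exp
(c V / 2)` becomes left multiplication by `exp (c V)`. -/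
theorem invol_moveLine_screw {V K : Line} (h : V.invol * K.invol = -(K.invol * V.invol)) (c : ℂ) :
    (moveLine (screw V c) K).invol =
      (Complex.cosh c • 1 + Complex.sinh c • V.invol) * K.invol := by
  have h1 : K.invol * (Complex.cosh (c / 2) • 1 - Complex.sinh (c / 2) • V.invol) =
      screwMatrix V c * K.invol := by
    rw [screwMatrix_eq, mul_sub, add_mul, smul_mul_assoc, smul_mul_assoc, mul_smul_comm,
      mul_smul_comm, h, one_mul, mul_one, smul_neg, sub_eq_add_neg]
  have h2 : screwMatrix V c * screwMatrix V c =
      Complex.cosh c • 1 + Complex.sinh c • V.invol := by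
    have e : c = 2 * (c / 2) := by ring
    conv_rhs => rw [e, Complex.cosh_two_mul, Complex.sinh_two_mul]
    rw [screwMatrix_eq, add_mul, mul_add, mul_add]
    simp only [smul_mul_smul_comm, one_mul, mul_one, V.invol_mul_self]
    module
  rw [screw, invol_moveLine, coe_inv_screwSL, mul_assoc, h1, ← mul_assoc]
  exact congrArg (· * K.invol) h2

namespace PauliTriple

variable {V M K : Line} {ε : ℝ}

theorem sq_complex (h : PauliTriple V M K ε) : (ε : ℂ) * ε = 1 := by exact_mod_cast h.sq

theorem anticomm_mid (h : PauliTriple V M K ε) : V.invol * M.invol = -(M.invol * V.invol) := by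
  rw [h.eq, mul_smul_comm, smul_mul_assoc, ← mul_assoc, mul_assoc V.invol K.invol, ← smul_neg,
    ← neg_neg (K.invol * V.invol), ← h.anticomm, mul_neg, neg_neg, mul_assoc]

theorem mul_eq (h : PauliTriple V M K ε) : M.invol * K.invol = (ε * Complex.I) • V.invol := by
  rw [h.eq, smul_mul_assoc, mul_assoc, K.invol_mul_self, mul_one]

theorem trace_left_right (h : PauliTriple V M K ε) : (V.invol * K.invol).trace = 0 := by
  have := congrArg trace h.anticomm
  rw [trace_neg, trace_mul_comm K.invol] at this
  exact self_eq_neg.1 this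

theorem trace_left_mid (h : PauliTriple V M K ε) : (V.invol * M.invol).trace = 0 := by
  have := congrArg trace h.anticomm_mid
  rw [trace_neg, trace_mul_comm M.invol] at this
  exact self_eq_neg.1 this

theorem trace_mid_right (h : PauliTriple V M K ε) : (M.invol * K.invol).trace = 0 := by
  rw [h.mul_eq, trace_smul, V.trace_invol, smul_zero]

/-- The involution of a moved line. -/
theorem invol_moves (h : PauliTriple V M K ε) (q : ℝ × ℝ) :
    (moves V M K q).invol = (Real.cosh q.1 * Real.cos q.2 : ℝ) • K.invol +
      (ε * (Real.cosh q.1 * Real.sin q.2) : ℝ) • M.invol +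
        (ε * Real.sinh q.1 : ℝ) • (Complex.I • V.invol) := by
  obtain ⟨d, τ⟩ := q
  set C : ℂ := Complex.cos τ with hC
  set S : ℂ := Complex.sin τ with hS
  have hY : (moveLine (rotation V τ) K).invol = (C • 1 + (S * Complex.I) • V.invol) * K.invol := by
    rw [rotation, invol_moveLine_screw h.anticomm, Complex.cosh_mul_I, Complex.sinh_mul_I]
  have hX : (moveLine (rotation V τ) M).invol = (C • 1 + (S * Complex.I) • V.invol) * M.invol := by
    rw [rotation, invol_moveLine_screw h.anticomm_mid, Complex.cosh_mul_I, Complex.sinh_mul_I]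
  -- Rotating both lines about `V` leaves their product, a multiple of `V.invol`, unchanged. The
  -- translation along `X` therefore mixes the rotated `K` only with the fixed direction `iV`.
  have hXY : (moveLine (rotation V τ) M).invol * (moveLine (rotation V τ) K).invol =
      (ε * Complex.I) • V.invol := by
    have h1 : M.invol * (C • 1 + (S * Complex.I) • V.invol) =
        (C • 1 - (S * Complex.I) • V.invol) * M.invol := by
      rw [mul_add, sub_mul, mul_smul_comm, mul_smul_comm, smul_mul_assoc, smul_mul_assoc,
        h.anticomm_mid, smul_neg, sub_neg_eq_add, mul_one, one_mul]
    have h2 : (C • 1 + (S * Complex.I) • V.invol) * (C • 1 - (S * Complex.I) • V.invol) = 1 := by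
      rw [add_mul, mul_sub, mul_sub]
      simp only [smul_mul_smul_comm, one_mul, mul_one, V.invol_mul_self]
      have e : C * C - S * Complex.I * (S * Complex.I) = 1 := by
        have := Complex.cos_sq_add_sin_sq (τ : ℂ)
        linear_combination this - S ^ 2 * Complex.I_mul_I
      calc _ = (C * C - S * Complex.I * (S * Complex.I)) •
            (1 : Matrix (Fin 2) (Fin 2) ℂ) := by module
        _ = 1 := by rw [e, one_smul]
    rw [hX, hY, mul_assoc, ← mul_assoc M.invol, h1, mul_assoc _ M.invol, ← mul_assoc, h2, one_mul,
      h.mul_eq]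
  have hanti := mul_eq_neg_mul_of_trace_eq_zero (moveLine (rotation V τ) M).trace_invol
    (moveLine (rotation V τ) K).trace_invol (by
      rw [hXY, trace_smul, V.trace_invol, smul_zero])
  have hVK : (S * Complex.I) • (V.invol * K.invol) = (ε * S) • M.invol := by
    rw [h.eq, smul_smul]
    congr 1
    linear_combination -(S * Complex.I) * h.sq_complex
  rw [moves, translation, invol_moveLine_screw hanti, add_mul, smul_mul_assoc, smul_mul_assoc,
    hXY, one_mul, hY, add_mul, smul_mul_assoc, smul_mul_assoc, hVK, one_mul, smul_add, smul_smul,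
    smul_smul, smul_smul]
  simp only [← Complex.coe_smul, smul_smul]
  push_cast
  rw [← hC, ← hS]
  congr 2
  · ring_nf
  · ring_nf

/-- The three involutions span the traceless matrices. -/
theorem eq_combination (h : PauliTriple V M K ε) {S : Matrix (Fin 2) (Fin 2) ℂ}
    (hS : S.trace = 0) :
    S = ((S * K.invol).trace / 2) • K.invol + ((S * M.invol).trace / 2) • M.invol +
      ((S * V.invol).trace / 2) • V.invol := by
  rw [← sub_eq_zero]
  set T := S - (((S * K.invol).trace / 2) • K.invol + ((S * M.invol).trace / 2) • M.invol +
      ((S * V.invol).trace / 2) • V.invol) with hT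
  have hKV : (K.invol * V.invol).trace = 0 := by rw [trace_mul_comm, h.trace_left_right]
  have hMV : (M.invol * V.invol).trace = 0 := by rw [trace_mul_comm, h.trace_left_mid]
  have hKM : (K.invol * M.invol).trace = 0 := by rw [trace_mul_comm, h.trace_mid_right]
  have hT0 : T.trace = 0 := by simp [hT, hS]
  have hTK : (T * K.invol).trace = 0 := by
    simp [hT, sub_mul, add_mul, h.trace_left_right, h.trace_mid_right]
  have hTM : (T * M.invol).trace = 0 := by
    simp [hT, sub_mul, add_mul, h.trace_left_mid, hKM]
  have hTV : (T * V.invol).trace = 0 := by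
    simp [hT, sub_mul, add_mul, hKV, hMV]
  have aK := mul_eq_neg_mul_of_trace_eq_zero hT0 K.trace_invol hTK
  have aM := mul_eq_neg_mul_of_trace_eq_zero hT0 M.trace_invol hTM
  have aV := mul_eq_neg_mul_of_trace_eq_zero hT0 V.trace_invol hTV
  -- `T` anticommutes with `V.invol` and `K.invol`, so it commutes with their product; it also
  -- anticommutes with `M.invol`, hence is zero.
  have h1 : T * M.invol = M.invol * T := by
    rw [h.eq, mul_smul_comm, smul_mul_assoc, ← mul_assoc, aV, neg_mul, mul_assoc, aK, mul_neg,
      neg_neg, mul_assoc]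
  rw [aM] at h1
  have h2 : M.invol * T = 0 := by
    have h3 : (2 : ℂ) • (M.invol * T) = 0 := by
      rw [two_smul]
      nth_rewrite 1 [← h1]
      exact neg_add_cancel _
    exact (smul_eq_zero.1 h3).resolve_left two_ne_zero
  rw [← one_mul T, ← M.invol_mul_self, mul_assoc, h2, mul_zero]

theorem combination_inj (h : PauliTriple V M K ε) {x y z x' y' z' : ℝ}
    (e : x • K.invol + y • M.invol + z • (Complex.I • V.invol) =
      x' • K.invol + y' • M.invol + z' • (Complex.I • V.invol)) : x = x' ∧ y = y' ∧ z = z' := by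
  have hKV : (K.invol * V.invol).trace = 0 := by rw [trace_mul_comm, h.trace_left_right]
  have hMV : (M.invol * V.invol).trace = 0 := by rw [trace_mul_comm, h.trace_left_mid]
  have hKM : (K.invol * M.invol).trace = 0 := by rw [trace_mul_comm, h.trace_mid_right]
  have eK := congrArg (fun S => (S * K.invol).trace) e
  have eM := congrArg (fun S => (S * M.invol).trace) e
  have eV := congrArg (fun S => (S * V.invol).trace) e
  simp [add_mul, h.trace_left_right, h.trace_mid_right] at eK
  simp [add_mul, h.trace_left_mid, hKM] at eM
  simp [add_mul, hKV, hMV] at eV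
  exact ⟨eK, eM, eV⟩

end PauliTriple

/-! ### Lines on a plane in terms of a move frame -/

/-- The real vector space of matrices that contains the involutions of the lines on the plane. -/
def Plane.IsSkew (P : Plane) (S : Matrix (Fin 2) (Fin 2) ℂ) : Prop :=
  Sᴴ * P.dual + P.dual * S = 0

theorem Plane.IsSkew.add {P : Plane} {S T : Matrix (Fin 2) (Fin 2) ℂ} (hS : P.IsSkew S)
    (hT : P.IsSkew T) : P.IsSkew (S + T) := by
  rw [Plane.IsSkew] at *
  rw [conjTranspose_add, add_mul, mul_add, add_add_add_comm, hS, hT, add_zero]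

theorem Plane.IsSkew.smul {P : Plane} {S : Matrix (Fin 2) (Fin 2) ℂ} (hS : P.IsSkew S) (r : ℝ) :
    P.IsSkew (r • S) := by
  rw [Plane.IsSkew] at *
  rw [conjTranspose_smul, star_trivial, smul_mul_assoc, mul_smul_comm, ← smul_add, hS, smul_zero]

/-- Skewness says `Uᴴ = -D U D⁻¹` with `D = P.dual`, so the trace of `S * T` equals its conjugate.
Coordinates of skew matrices in an orthogonal skew basis are therefore real. -/
theorem Plane.IsSkew.trace_mul_im {P : Plane} {S T : Matrix (Fin 2) (Fin 2) ℂ} (hS : P.IsSkew S)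
    (hT : P.IsSkew T) : (S * T).trace.im = 0 := by
  have hu : IsUnit P.dual.det := isUnit_iff_ne_zero.2 P.det_dual_ne_zero
  have key : ∀ {U : Matrix (Fin 2) (Fin 2) ℂ}, P.IsSkew U → Uᴴ = -(P.dual * U * P.dual⁻¹) := by
    intro U hU
    rw [← neg_mul, ← eq_neg_of_add_eq_zero_left hU, mul_nonsing_inv_cancel_right _ _ hu]
  rw [← Complex.conj_eq_iff_im, ← Complex.star_def, ← trace_conjTranspose, conjTranspose_mul,
    key hS, key hT, neg_mul_neg]
  have e : P.dual * T * P.dual⁻¹ * (P.dual * S * P.dual⁻¹) = P.dual * (T * S) * P.dual⁻¹ := by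
    rw [← mul_assoc, ← mul_assoc, nonsing_inv_mul_cancel_right _ _ hu, ← mul_assoc]
  rw [e, trace_mul_comm, nonsing_inv_mul_cancel_left _ _ hu, trace_mul_comm]

theorem Line.IsPerpPlaneAt.isPerpAt {V K : Line} {P : Plane} {X : H3} (h : V.IsPerpPlaneAt P X)
    (hK : K.LiesOn P) (hX : X ∈ K.points) : V.IsPerpAt K X := by
  obtain ⟨-, T, hT, c, hc⟩ := h
  obtain ⟨s, t, hs, ht, hX⟩ := hX
  obtain ⟨h1, h2⟩ := (K.liesOn_iff P).1 hK
  refine ⟨T, _, hT, ⟨s, t, hs, ht, hX, rfl⟩, ?_⟩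
  have h3 := P.minkowski_add_smul (-s) t (null K.src) (null K.tgt)
  rw [← Plane.form, ← Plane.form, h1, h2, mul_zero, mul_zero, add_zero, neg_smul,
    neg_add_eq_sub] at h3
  rw [minkowski] at h3 ⊢
  rw [hc, smul_mul_assoc, trace_smul, Complex.real_smul, Complex.re_ofReal_mul, h3, mul_zero]

/-- The tangent of `V` is a multiple of the normal, and `P.dual` is the adjugate of the normal; so
`P.dual * V.invol` and `V.involᴴ * P.dual` are the same multiple of the adjugate of `X`. The factor
`I` makes them cancel. This is the negative direction of the skew space. -/
theorem Line.IsPerpPlaneAt.isSkew {V : Line} {P : Plane} {X : H3} (h : V.IsPerpPlaneAt P X) :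
    P.IsSkew (Complex.I • V.invol) := by
  obtain ⟨-, T, hT, c, hc⟩ := h
  obtain ⟨hVX, hherm⟩ := (V.isTangentAt_iff X T).1 hT
  have hX : X.1 * X.1.adjugate = 1 := by rw [mul_adjugate, X.2.2, one_smul]
  have hX' : X.1.adjugate * X.1 = 1 := by rw [adjugate_mul, X.2.2, one_smul]
  have e1 : P.dual * T = (c * P.normal.det) • 1 := by
    rw [hc, Plane.dual, mul_smul_comm, adjugate_mul, ← Complex.coe_smul, smul_smul]
  have e2 : T * P.dual = (c * P.normal.det) • 1 := by
    rw [hc, Plane.dual, smul_mul_assoc, mul_adjugate, ← Complex.coe_smul, smul_smul]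
  have e3 : T = X.1 * V.involᴴ := by
    rw [← hherm.eq, hVX, conjTranspose_mul, X.2.1.1.eq]
  have f1 : P.dual * V.invol = (c * P.normal.det) • X.1.adjugate := by
    rw [← mul_one (P.dual * V.invol), ← hX, mul_assoc, ← mul_assoc V.invol, ← hVX, ← mul_assoc, e1,
      smul_mul_assoc, one_mul]
  have f2 : V.involᴴ * P.dual = (c * P.normal.det) • X.1.adjugate := by
    rw [← one_mul (V.involᴴ * P.dual), ← hX', mul_assoc, ← mul_assoc X.1, ← e3, e2,
      mul_smul_comm, mul_one]
  rw [Plane.IsSkew, conjTranspose_smul, smul_mul_assoc, mul_smul_comm, f1, f2]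
  simp

theorem IsMoveFrame.exists_pauliTriple {P : Plane} {A : PSL(2, ℂ)} {K V M : Line} {v : H3}
    (h : IsMoveFrame P A K v V M) (hK : K.LiesOn P) : ∃ ε, PauliTriple V M K ε := by
  obtain ⟨hv, -, hV, hM, hMK⟩ := h
  obtain ⟨hvM, -, hMK⟩ := (M.isPerpAt_iff K v).1 hMK
  exact NsdcPlanar.exists_pauliTriple ((V.isPerpAt_iff K v).1 (hV.isPerpAt hK hv)).2.2
    ((V.isPerpAt_iff M v).1 (hV.isPerpAt hM hvM)).2.2 hMK

theorem IsMoveFrame.moves_liesOn {P : Plane} {A : PSL(2, ℂ)} {K V M : Line} {v : H3}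
    (h : IsMoveFrame P A K v V M) (hK : K.LiesOn P) (q : ℝ × ℝ) : (moves V M K q).LiesOn P := by
  obtain ⟨ε, hε⟩ := h.exists_pauliTriple hK
  rw [Line.liesOn_iff_invol, hε.invol_moves]
  exact ((Plane.IsSkew.smul ((K.liesOn_iff_invol P).1 hK) _).add
    (Plane.IsSkew.smul ((M.liesOn_iff_invol P).1 h.2.2.2.1) _)).add (h.2.2.1.isSkew.smul _)

/-- Polar coordinates on the hyperboloid of one sheet, up to sign. -/
theorem exists_hyperboloid_coordinates {ε x y z : ℝ} (hε : ε * ε = 1)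
    (h : x * x + y * y - z * z = 1) :
    ∃ q ∈ moduliFactor, ∃ σ : ℝ, (σ = 1 ∨ σ = -1) ∧ Real.cosh q.1 * Real.cos q.2 = σ * x ∧
      ε * (Real.cosh q.1 * Real.sin q.2) = σ * y ∧ ε * Real.sinh q.1 = σ * z := by
  -- The sign is chosen to make `d ≥ 0`; it amounts to an orientation of the line.
  obtain ⟨σ, hσ, hz⟩ : ∃ σ : ℝ, (σ = 1 ∨ σ = -1) ∧ 0 ≤ σ * (ε * z) := by
    rcases le_total 0 (ε * z) with h | h
    · exact ⟨1, Or.inl rfl, by linarith⟩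
    · exact ⟨-1, Or.inr rfl, by linarith⟩
  have hσ2 : σ * σ = 1 := by rcases hσ with rfl | rfl <;> norm_num
  -- Its modulus is `cosh d` and its argument, taken in `(-π, π]`, is `τ`.
  set w : ℂ := ⟨σ * x, σ * (ε * y)⟩ with hw
  have hn : Real.cosh (Real.arsinh (σ * (ε * z))) = ‖w‖ := by
    rw [Real.cosh_arsinh, Complex.norm_eq_sqrt_sq_add_sq]
    congr 1
    show 1 + _ = (σ * x) ^ 2 + (σ * (ε * y)) ^ 2
    linear_combination (ε * ε * (z * z) - x * x - ε * ε * (y * y)) * hσ2 + (z * z - y * y) * hε - h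
  refine ⟨(Real.arsinh (σ * (ε * z)), w.arg), ⟨Real.arsinh_nonneg_iff.2 hz, Complex.arg_mem_Ioc w⟩,
    σ, hσ, ?_, ?_, ?_⟩
  · rw [hn, Complex.norm_mul_cos_arg]
  · rw [hn, Complex.norm_mul_sin_arg]
    show ε * (σ * (ε * y)) = σ * y
    linear_combination σ * y * hε
  · rw [Real.sinh_arsinh]
    linear_combination σ * z * hε

/-- All involutions involved are skew, so `N.invol` has real coordinates in the basis `K`, `M`,
`iV`, and its square being `1` puts them on the hyperboloid. -/
theorem IsMoveFrame.exists_moves {P : Plane} {A : PSL(2, ℂ)} {K V M : Line} {v : H3}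
    (h : IsMoveFrame P A K v V M) (hK : K.LiesOn P) {N : Line} (hN : N.LiesOn P) :
    ∃ q ∈ moduliFactor, halfTurn (moves V M K q) = halfTurn N := by
  obtain ⟨ε, hε⟩ := h.exists_pauliTriple hK
  have sN : P.IsSkew N.invol := (N.liesOn_iff_invol P).1 hN
  have sK : P.IsSkew K.invol := (K.liesOn_iff_invol P).1 hK
  have sM : P.IsSkew M.invol := (M.liesOn_iff_invol P).1 h.2.2.2.1
  have sV := h.2.2.1.isSkew
  have real : ∀ {u : ℂ}, u.im = 0 → ∃ r : ℝ, u = (2 * r : ℝ) := by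
    intro u hu
    exact ⟨u.re / 2, Complex.ext (by simp; ring) (by simpa using hu)⟩
  obtain ⟨x, hx⟩ := real (sN.trace_mul_im sK)
  obtain ⟨y, hy⟩ := real (sN.trace_mul_im sM)
  -- The factor `-1` compensates for `iV` having square `-1`.
  obtain ⟨z, hz⟩ := real (sN.trace_mul_im (sV.smul (-1)))
  have hzV : (N.invol * V.invol).trace = 2 * (z * Complex.I) := by
    have : (N.invol * ((-1 : ℝ) • Complex.I • V.invol)).trace =
        -Complex.I * (N.invol * V.invol).trace := by simp
    rw [this] at hz
    push_cast at hz
    linear_combination Complex.I * hz + (N.invol * V.invol).trace * Complex.I_mul_I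
  have hcomb := hε.eq_combination N.trace_invol
  have hsum : x * x + y * y - z * z = 1 := by
    have h1 : (N.invol * N.invol).trace = 2 := by simp
    nth_rewrite 2 [hcomb] at h1
    rw [mul_add, mul_add, mul_smul_comm, mul_smul_comm, mul_smul_comm, trace_add, trace_add,
      trace_smul, trace_smul, trace_smul, hx, hy, hzV, smul_eq_mul, smul_eq_mul, smul_eq_mul] at h1
    push_cast at h1
    have h2 : (x * x + y * y - z * z : ℂ) = 1 := by
      linear_combination (1 / 2 : ℂ) * h1 - (z * z) * Complex.I_mul_I
    exact_mod_cast h2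
  have hN' : N.invol = x • K.invol + y • M.invol + z • (Complex.I • V.invol) := by
    rw [hx, hy, hzV] at hcomb
    rw [hcomb]
    simp only [← Complex.coe_smul, smul_smul]
    congr 2
    · congr 1; push_cast; ring
    · congr 1; push_cast; ring
    · ring
  obtain ⟨q, hq, σ, hσ, e1, e2, e3⟩ := exists_hyperboloid_coordinates hε.sq hsum
  refine ⟨q, hq, ?_⟩
  have e : (moves V M K q).invol = σ • N.invol := by
    rw [hε.invol_moves, e1, e2, e3, hN']
    module
  rw [halfTurn_eq_halfTurn_iff, e]
  rcases hσ with rfl | rfl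
  · left; rw [one_smul]
  · right; rw [neg_one_smul]

theorem eq_of_cos_eq_of_sin_eq {τ τ' : ℝ} (h : τ ∈ Set.Ioc (-Real.pi) Real.pi)
    (h' : τ' ∈ Set.Ioc (-Real.pi) Real.pi) (hc : Real.cos τ = Real.cos τ')
    (hs : Real.sin τ = Real.sin τ') : τ = τ' := by
  rw [← Complex.arg_cos_add_sin_mul_I h, ← Complex.arg_cos_add_sin_mul_I h', ← Complex.ofReal_cos,
    ← Complex.ofReal_sin, hc, hs, Complex.ofReal_cos, Complex.ofReal_sin]

/-- Equal involutions give equal pairs. Opposite ones give `sinh d + sinh d' = 0` with both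
distances nonnegative, so both vanish and the angles are antipodal. -/
theorem PauliTriple.halfTurn_moves_eq_iff {V M K : Line} {ε : ℝ} (h : PauliTriple V M K ε)
    {q r : ℝ × ℝ} (hq : q ∈ moduliFactor) (hr : r ∈ moduliFactor) :
    halfTurn (moves V M K q) = halfTurn (moves V M K r) ↔ SameMove q r := by
  obtain ⟨d, τ⟩ := q
  obtain ⟨d', τ'⟩ := r
  obtain ⟨hd, hτ⟩ := hq
  obtain ⟨hd', hτ'⟩ := hr
  simp only [Set.mem_Ici] at hd hd' hτ hτ'
  have hε : ε ≠ 0 := left_ne_zero_of_mul_eq_one h.sq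
  rw [halfTurn_eq_halfTurn_iff, h.invol_moves, h.invol_moves, SameMove]
  dsimp only
  constructor
  · rintro (e | e)
    · left
      obtain ⟨e1, e2, e3⟩ := h.combination_inj e
      have hdd : d = d' := Real.sinh_injective (mul_left_cancel₀ hε e3)
      subst hdd
      have hcosh := (Real.cosh_pos d).ne'
      rw [eq_of_cos_eq_of_sin_eq hτ hτ' (mul_left_cancel₀ hcosh e1)
        (mul_left_cancel₀ hcosh (mul_left_cancel₀ hε e2))]
    · right
      rw [neg_add, neg_add, ← neg_smul, ← neg_smul, ← neg_smul] at e
      obtain ⟨e1, e2, e3⟩ := h.combination_inj e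
      have hsum : Real.sinh d + Real.sinh d' = 0 := by
        apply mul_left_cancel₀ hε
        linear_combination e3
      have p1 := Real.sinh_nonneg_iff.2 hd
      have p2 := Real.sinh_nonneg_iff.2 hd'
      have hd0 : d = 0 := Real.sinh_eq_zero.1 (by linarith)
      have hd0' : d' = 0 := Real.sinh_eq_zero.1 (by linarith)
      subst hd0 hd0'
      rw [Real.cosh_zero, one_mul, one_mul] at e1 e2
      have e2' : Real.sin τ = -Real.sin τ' := by
        apply mul_left_cancel₀ hε
        linear_combination e2
      refine ⟨rfl, rfl, ?_⟩
      -- The sign of `τ'` decides which of `τ' ± π` lies in `(-π, π]`.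
      rcases le_or_gt τ' 0 with hle | hlt
      · left
        have := eq_of_cos_eq_of_sin_eq hτ (τ' := τ' + Real.pi)
          ⟨by linarith [hτ'.1, Real.pi_pos], by linarith⟩ (by rw [Real.cos_add_pi, e1])
          (by rw [Real.sin_add_pi, e2'])
        rw [this]; ring
      · right
        have := eq_of_cos_eq_of_sin_eq hτ (τ' := τ' - Real.pi)
          ⟨by linarith, by linarith [hτ'.2, Real.pi_pos]⟩ (by rw [Real.cos_sub_pi, e1])
          (by rw [Real.sin_sub_pi, e2'])
        rw [this]; ring
  · rintro (e | ⟨rfl, rfl, e⟩)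
    · left
      obtain ⟨rfl, rfl⟩ := Prod.mk.inj e
      rfl
    · right
      have hc : Real.cos τ = -Real.cos τ' ∧ Real.sin τ = -Real.sin τ' := by
        rcases e with e | e
        · rw [eq_add_of_sub_eq e, add_comm, Real.cos_add_pi, Real.sin_add_pi]
          exact ⟨rfl, rfl⟩
        · rw [eq_add_of_sub_eq e, add_comm, Real.cos_add_pi, Real.sin_add_pi, neg_neg, neg_neg]
          exact ⟨rfl, rfl⟩
      rw [hc.1, hc.2, Real.sinh_zero]
      module

end NsdcPlanar

/-! ### The moduli theorem -/

theorem mainTheorem1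
    (PA P PB : Plane) (A B : PSL(2, ℂ)) (LA L LB : Line)
    (hG : IsNsdcGroupOn PA P PB A B LA L LB)
    (θA θ θB : ℝ) (hθA : IsPullBackAngle PA LA θA) (hθ : IsPullBackAngle P L θ)
    (hθB : IsPullBackAngle PB LB θB)
    (vA v vB : H3) (VA V VB MA M MB : Line)
    (hA : IsMoveFrame PA A LA vA VA MA) (h : IsMoveFrame P A L v V M)
    (hB : IsMoveFrame PB B LB vB VB MB) :
    (∀ qA ∈ moduliFactor, ∀ q ∈ moduliFactor, ∀ qB ∈ moduliFactor,
      IsNsdcGroupOn PA P PB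
        (markedGroup (moves VA MA LA qA) (moves V M L q) (moves VB MB LB qB)).1
        (markedGroup (moves VA MA LA qA) (moves V M L q) (moves VB MB LB qB)).2
        (moves VA MA LA qA) (moves V M L q) (moves VB MB LB qB)) ∧
    (∀ G' ∈ planarFamily PA P PB,
      ∃ qA ∈ moduliFactor, ∃ q ∈ moduliFactor, ∃ qB ∈ moduliFactor,
        G' = markedGroup (moves VA MA LA qA) (moves V M L q) (moves VB MB LB qB)) ∧
    (∀ qA ∈ moduliFactor, ∀ q ∈ moduliFactor, ∀ qB ∈ moduliFactor,
      ∀ rA ∈ moduliFactor, ∀ r ∈ moduliFactor, ∀ rB ∈ moduliFactor,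
        (markedGroup (moves VA MA LA qA) (moves V M L q) (moves VB MB LB qB) =
            markedGroup (moves VA MA LA rA) (moves V M L r) (moves VB MB LB rB) ↔
          SameMove qA rA ∧ SameMove q r ∧ SameMove qB rB)) := by
  obtain ⟨hT, -, hLA, hL, hLB⟩ := hG
  have lA := hA.moves_liesOn hLA
  have l := h.moves_liesOn hL
  have lB := hB.moves_liesOn hLB
  refine ⟨fun qA _ q _ qB _ => IsNsdcGroupOn.of_liesOn hT (lA qA) (l q) (lB qB), ?_, ?_⟩
  · rintro ⟨A', B'⟩ ⟨KA, K, KB, -, ⟨-, rfl, rfl⟩, hKA, hK, hKB⟩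
    obtain ⟨qA, hqA, eA⟩ := hA.exists_moves hLA hKA
    obtain ⟨q, hq, e⟩ := h.exists_moves hL hK
    obtain ⟨qB, hqB, eB⟩ := hB.exists_moves hLB hKB
    refine ⟨qA, hqA, q, hq, qB, hqB, ?_⟩
    rw [markedGroup, eA, e, eB]
  · intro qA hqA q hq qB hqB rA hrA r hr rB hrB
    obtain ⟨εA, hεA⟩ := hA.exists_pauliTriple hLA
    obtain ⟨ε, hε⟩ := h.exists_pauliTriple hL
    obtain ⟨εB, hεB⟩ := hB.exists_pauliTriple hLB
    -- The three factors decouple: the marked group determines each half-turn, and each half-turn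
    -- determines its pair up to `SameMove`.
    rw [hT.markedGroup_eq_iff (lA qA) (l q) (lB qB) (lA rA) (l r) (lB rB),
      hεA.halfTurn_moves_eq_iff hqA hrA, hε.halfTurn_moves_eq_iff hq hr,
      hεB.halfTurn_moves_eq_iff hqB hrB]
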